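/- Let $\mathcal A$ be a unital complex $C^\star$-algebra, let $\mathcal A^{\otimes n}$ denote its $n$-fold (completed) projective tensor power ($\mathcal A^{\otimes 0}=\mathbb C$), and let $X:[0,1]\to\mathcal A$ be a smooth path. *Trees.* A levelled planar binary tree $\tau$ with $\|\tau\|=n$ internal vertices and $|\tau|=n+1$ leaves is identified with a permutation $\sigma\in\mathfrak S_n$: $\sigma(i)$ is the level of the internal vertex between the $i$-th and $(i+1)$-st leaves, the root having level $1$; $\bullet$ is the tree with $n=0$. The subtrees $\tau'\subset\tau$ are the trees $\sigma\cap[p]$, $0\le p\le n$, obtained by keeping in the word $\sigma(1)\cdots\sigma(n)$ only the letters $\le p$. A levelled forest $f$ with $m$ trees, $N$ internal vertices and $N+m$ leaves is a pair $(\rho,c)$ where $\rho\in\mathfrak S_N$ and $c=(c_1,\dots,c_m)$ is a sequence of non-negative integers with sum $N$. For $\tau'=\sigma\cap[p]$, the forest $\tau\backslash\tau'$ is $(\rho,c)$ where $\rho\in\mathfrak S_{n-p}$ is the word of the letters of $\sigma$ larger than $p$, each decreased by $p$, and $c=(c_1,\dots,c_{p+1})$ gives the numbers of these letters located before the first, between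 consecutive, and after the last of the letters $\le p$ of $\sigma$. *Contraction operators.* For $s,t\in[0,1]$ and $f=(\rho,c)$ as above, $\mathbb X^f_{s,t}:\mathcal A^{\otimes(N+m)}\to\mathcal A^{\otimes m}$ is the continuous linear map given by $$\mathbb X^f_{s,t}\Big(\bigotimes_{j=1}^m A_{j,0}\otimes\cdots\otimes A_{j,c_j}\Big)=\int_{\Delta^N_{s,t}}\bigotimes_{j=1}^m A_{j,0}\cdot dX_{t_{\rho(e_j+1)}}\cdot A_{j,1}\cdots dX_{t_{\rho(e_j+c_j)}}\cdot A_{j,c_j},\qquad e_j=c_1+\cdots+c_{j-1},$$ where $\int_{\Delta^N_{s,t}}$ is the oriented iterated integral $\int_s^t\int_s^{t_1}\cdots\int_s^{t_{N-1}}$ (for $s\le t$, the integral over $t>t_1>\cdots>t_N>s$). *The algebra.* Let $\mathsf{LT}^\#(\mathcal A)=\bigoplus_\tau \mathsf{LT}^\#(\mathcal A)(\tau)$ (algebraic direct sum over all levelled trees) with $\mathsf{LT}^\#(\mathcal A)(\tau)=\mathcal A^{\otimes|\tau|}\,\tau$, endowed with the bilinear product $$(A\,\alpha)\sqcup\!\sqcup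 (B\,\beta)=\sum_{s}(A\cdot B)\;s\circ(\alpha\otimes\beta),$$ where $s$ runs over the permutations of $\{1,\dots,\|\alpha\|+\|\beta\|\}$ that are increasing on $\{1,\dots,\|\alpha\|\}$ and on $\{\|\alpha\|+1,\dots,\|\alpha\|+\|\beta\|\}$, $\alpha\otimes\beta$ is the shifted concatenation of permutations, and $(A_0\otimes\cdots\otimes A_n)\cdot(B_0\otimes\cdots\otimes B_m)=A_0\otimes\cdots\otimes(A_nB_0)\otimes\cdots\otimes B_m$; the unit is $\mathbf 1\,\bullet$. Let $$G(\mathcal A)=\Big\{\varphi\in\mathrm{Hom}_{\mathrm{Alg}}(\mathsf{LT}^\#(\mathcal A),\mathsf{LT}^\#(\mathcal A)):\ (\varphi-\mathrm{id})(\mathsf{LT}^\#(\mathcal A)(\tau))\subset\bigoplus_{\tau'\subsetneq\tau}\mathsf{LT}^\#(\mathcal A)(\tau')\ \text{ for every levelled tree }\tau\Big\},$$ where $\mathrm{Hom}_{\mathrm{Alg}}$ denotes the linear maps preserving the product $\sqcup\!\sqcup $ and the unit. For $s,t\in[0,1]$ let $\bar{\mathbb X}_{s,t}$ be the linear endomorphism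 of $\mathsf{LT}^\#(\mathcal A)$ with $$\bar{\mathbb X}_{s,t}(a\,\tau)=\sum_{\tau'\subset\tau}\mathbb X^{\tau\backslash\tau'}_{s,t}(a)\,\tau',\qquad a\in\mathcal A^{\otimes|\tau|}.$$ **Theorem.** $G(\mathcal A)$ is a group under composition, and 1. $\bar{\mathbb X}_{s,t}\in G(\mathcal A)$ for all $(s,t)\in[0,1]^2$; 2. $\bar{\mathbb X}_{s,t}=\bar{\mathbb X}_{u,t}\circ\bar{\mathbb X}_{s,u}$ for all $(s,u,t)\in[0,1]^3$. -/

import Mathlib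

open scoped TensorProduct DirectSum ContDiff

namespace LevelledSignature

noncomputable section

/-! ### Levelled trees and forests, presented as permutations and split permutations -/

/-- A levelled planar binary tree with `n` internal vertices (hence `n + 1` leaves), presented as
the permutation `σ` of `{0, …, n - 1}` such that `σ i` is the level of the internal vertex lying
between the leaves `i` and `i + 1` (levels start at `0`, at the root). -/
abbrev LTree : Type := Σ n : ℕ, Equiv.Perm (Fin n)

/-- The root tree: one leaf and no internal vertex. -/
def LTree.root : LTree := ⟨0, 1⟩

/-- A levelled planar binary forest with `m` trees and `n` leaves, presented as a split permutation:
a permutation `perm` of its `gens` generations (= internal vertices) and the weak composition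
`parts` of `gens` recording the numbers of internal vertices of the successive trees. -/
structure LForest (m n : ℕ) where
  gens : ℕ
  perm : Equiv.Perm (Fin gens)
  parts : Fin m → ℕ
  sum_parts : ∑ j, parts j = gens
  leaves : gens + m = n

section Cut

variable {n : ℕ} (σ : Equiv.Perm (Fin n)) (p : Fin (n + 1))

/-- The positions of the letters of the word `σ` among the `p` smallest ones. -/
def lowPos : Finset (Fin n) := {i | (σ i : ℕ) < p}

/-- The positions of the other letters of the word `σ`. -/
def highPos : Finset (Fin n) := {i | (p : ℕ) ≤ σ i}

theorem card_lowPos : (lowPos σ p).card = p := by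
  have h : (lowPos σ p).map σ.toEmbedding =
      Finset.univ.filter fun j : Fin n => (j : ℕ) < p := by
    ext j
    simp only [lowPos, Finset.mem_map_equiv, Finset.mem_filter, Finset.mem_univ, true_and,
      Equiv.apply_symm_apply]
  rw [← Finset.card_map σ.toEmbedding, h, Fin.card_filter_val_lt]
  exact min_eq_right p.is_le

theorem card_highPos : (highPos σ p).card = n - p := by
  have h : highPos σ p = (lowPos σ p)ᶜ := by
    ext j
    simp [lowPos, highPos]
  rw [h, Finset.card_compl, card_lowPos, Fintype.card_fin]

/-- The position in `σ` of the `k`-th letter of the subword of the `p` smallest letters. -/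
def lowEmb : Fin p ↪o Fin n := (lowPos σ p).orderEmbOfFin (card_lowPos σ p)

/-- The position in `σ` of the `k`-th letter of the subword of the remaining letters. -/
def highEmb : Fin (n - p) ↪o Fin n := (highPos σ p).orderEmbOfFin (card_highPos σ p)

theorem lt_of_lowEmb (k : Fin p) : (σ (lowEmb σ p k) : ℕ) < p := by
  have h := (lowPos σ p).orderEmbOfFin_mem (card_lowPos σ p) k
  exact (Finset.mem_filter.1 h).2

theorem le_of_highEmb (k : Fin (n - p)) : (p : ℕ) ≤ σ (highEmb σ p k) := by
  have h := (highPos σ p).orderEmbOfFin_mem (card_highPos σ p) k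
  exact (Finset.mem_filter.1 h).2

/-- The subword of `σ` made of its `p` smallest letters. -/
def lowWord : Equiv.Perm (Fin p) :=
  Equiv.ofBijective (fun k => ⟨σ (lowEmb σ p k), lt_of_lowEmb σ p k⟩)
    (Finite.injective_iff_bijective.1 fun k l h => by
      have h1 : (σ (lowEmb σ p k) : ℕ) = σ (lowEmb σ p l) :=
        congrArg (fun q : Fin p => (q : ℕ)) h
      exact (lowEmb σ p).injective (σ.injective (Fin.ext h1)))

/-- The subword of `σ` made of its `n - p` largest letters, relabelled by subtracting `p`. -/
def highWord : Equiv.Perm (Fin (n - p)) :=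
  Equiv.ofBijective
    (fun k => ⟨σ (highEmb σ p k) - p, by
      have h1 := le_of_highEmb σ p k
      have h2 := (σ (highEmb σ p k)).isLt
      omega⟩)
    (Finite.injective_iff_bijective.1 fun k l h => by
      have h0 : (σ (highEmb σ p k) : ℕ) - p = σ (highEmb σ p l) - p :=
        congrArg (fun q : Fin (n - p) => (q : ℕ)) h
      have h1 := le_of_highEmb σ p k
      have h2 := le_of_highEmb σ p l
      exact (highEmb σ p).injective (σ.injective (Fin.ext (by omega))))

/-- The number of consecutive large letters of the word `σ` between the `j`-th and the `(j + 1)`-st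
of its `p` small letters (before the first one for `j = 0`, after the last one for `j = p`). -/
def gapParts (j : Fin ((p : ℕ) + 1)) : ℕ :=
  ((highPos σ p).filter fun i => ((lowPos σ p).filter (· < i)).card = j).card

theorem sum_gapParts : ∑ j, gapParts σ p j = n - p := by
  rw [← card_highPos σ p]
  have hlt : ∀ i : Fin n, ((lowPos σ p).filter (· < i)).card < (p : ℕ) + 1 := fun i =>
    Nat.lt_succ_of_le ((Finset.card_filter_le _ _).trans (card_lowPos σ p).le)
  rw [Finset.card_eq_sum_card_fiberwise (t := Finset.univ)
    (f := fun i => (⟨((lowPos σ p).filter (· < i)).card, hlt i⟩ : Fin ((p : ℕ) + 1)))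
    (fun _ _ => Finset.mem_coe.2 (Finset.mem_univ _))]
  refine Finset.sum_congr rfl fun j _ => ?_
  simp only [gapParts, Fin.ext_iff]

end Cut

/-- The levelled subtree `τ'` of `τ` made of the `p` lowest generations of `τ`. -/
def LTree.lower (τ : LTree) (p : Fin (τ.1 + 1)) : LTree := ⟨p, lowWord τ.2 p⟩

/-- The levelled forest `τ \ τ'`, where `τ'` is the subtree of the `p` lowest generations of `τ`:
the upper component of the horizontal cut of `τ` at level `p`. -/
def LTree.upper (τ : LTree) (p : Fin (τ.1 + 1)) : LForest ((τ.lower p).1 + 1) (τ.1 + 1) where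
  gens := τ.1 - p
  perm := highWord τ.2 p
  parts := gapParts τ.2 p
  sum_parts := sum_gapParts τ.2 p
  leaves := by
    have := p.is_le
    simp only [LTree.lower]
    omega

/-- `τ'` is a levelled subtree of `τ` (possibly `τ` itself). -/
def LTree.IsSubtree (τ' τ : LTree) : Prop := ∃ p, τ' = τ.lower p

/-- The shuffles of `{0, …, n - 1}` and `{n, …, n + m - 1}`. -/
def shuffles (n m : ℕ) : Finset (Equiv.Perm (Fin (n + m))) :=
  open Classical in
  {s | StrictMono (fun i : Fin n => s (Fin.castAdd m i)) ∧
    StrictMono (fun i : Fin m => s (Fin.natAdd n i))}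

/-- The shifted concatenation `α ⊗ (β + n)` of two permutations. -/
def shiftedConcat {n m : ℕ} (α : Equiv.Perm (Fin n)) (β : Equiv.Perm (Fin m)) :
    Equiv.Perm (Fin (n + m)) :=
  finSumFinEquiv.permCongr (Equiv.Perm.sumCongr α β)

/-! ### Projective tensor powers -/

section Tensor

variable (A : Type*) [CStarAlgebra A]

/-- The `n`-fold projective tensor power of `A`: the completion of the algebraic tensor power for
the projective norm. -/
def TPow (n : ℕ) : Type _ := UniformSpace.Completion (⨂[ℂ] _ : Fin n, A)

instance (n : ℕ) : NormedAddCommGroup (TPow A n) :=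
  inferInstanceAs (NormedAddCommGroup (UniformSpace.Completion (⨂[ℂ] _ : Fin n, A)))

instance (n : ℕ) : NormedSpace ℂ (TPow A n) :=
  inferInstanceAs (NormedSpace ℂ (UniformSpace.Completion (⨂[ℂ] _ : Fin n, A)))

instance (n : ℕ) : CompleteSpace (TPow A n) :=
  inferInstanceAs (CompleteSpace (UniformSpace.Completion (⨂[ℂ] _ : Fin n, A)))

variable {A}

/-- The pure tensor `a 0 ⊗ ⋯ ⊗ a (n - 1)`, as a continuous multilinear map. -/
def pureTensor (n : ℕ) : ContinuousMultilinearMap ℂ (fun _ : Fin n => A) (TPow A n) :=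
  (UniformSpace.Completion.toComplL (𝕜 := ℂ) (E := ⨂[ℂ] _ : Fin n, A)
    ).compContinuousMultilinearMap (PiTensorProduct.tprodL ℂ)

section Lift

variable {F : Type*} [NormedAddCommGroup F] [NormedSpace ℂ F] [CompleteSpace F]

theorem norm_lift_le {n : ℕ} (f : ContinuousMultilinearMap ℂ (fun _ : Fin n => A) F) :
    ‖(PiTensorProduct.liftIsometry ℂ (fun _ : Fin n => A) F f).fromCompletion‖ ≤ 1 * ‖f‖ := by
  refine ContinuousLinearMap.opNorm_le_bound _ (by positivity) fun x => ?_
  induction x using UniformSpace.Completion.induction_on with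
  | hp => exact isClosed_le (by fun_prop) (by fun_prop)
  | ih x =>
    rw [ContinuousLinearMap.fromCompletion_apply_coe, one_mul, UniformSpace.Completion.norm_coe,
      PiTensorProduct.liftIsometry_apply_apply]
    exact PiTensorProduct.norm_eval_le_projectiveSeminorm f x

/-- The continuous linear extension of a continuous multilinear map to the completed tensor power. -/
def liftCompl (n : ℕ) : ContinuousMultilinearMap ℂ (fun _ : Fin n => A) F →L[ℂ]
    (UniformSpace.Completion (⨂[ℂ] _ : Fin n, A) →L[ℂ] F) :=
  LinearMap.mkContinuous
    { toFun := fun f => (PiTensorProduct.liftIsometry ℂ (fun _ : Fin n => A) F f).fromCompletion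
      map_add' := fun f g => ContinuousLinearMap.fromCompletion_unique _ _ fun e => by
        rw [add_apply, ContinuousLinearMap.fromCompletion_apply_coe,
          ContinuousLinearMap.fromCompletion_apply_coe, map_add, add_apply]
      map_smul' := fun c f => ContinuousLinearMap.fromCompletion_unique _ _ fun e => by
        rw [RingHom.id_apply, smul_apply,
          ContinuousLinearMap.fromCompletion_apply_coe, map_smul, smul_apply] }
    1 norm_lift_le

/-- The continuous linear extension of a continuous multilinear map to the projective tensor
power. -/
def lift (n : ℕ) : ContinuousMultilinearMap ℂ (fun _ : Fin n => A) F →L[ℂ] (TPow A n →L[ℂ] F) :=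
  liftCompl n

theorem lift_pureTensor {n : ℕ} (f : ContinuousMultilinearMap ℂ (fun _ : Fin n => A) F)
    (a : Fin n → A) : lift n f (pureTensor n a) = f a := by
  have h := (PiTensorProduct.liftIsometry ℂ (fun _ : Fin n => A) F f).fromCompletion_apply_coe
    (PiTensorProduct.tprodL ℂ a)
  rw [PiTensorProduct.liftIsometry_apply_apply] at h
  exact h.trans (by simp)

/-- The continuous bilinear extension of a continuous multilinear map in two groups of
variables. -/
def lift₂ (k n : ℕ) (f : ContinuousMultilinearMap ℂ (fun _ : Fin k ⊕ Fin n => A) F) :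
    TPow A k →L[ℂ] TPow A n →L[ℂ] F :=
  (lift n).comp (lift k f.currySum)

theorem lift₂_pureTensor {k n : ℕ} (f : ContinuousMultilinearMap ℂ (fun _ : Fin k ⊕ Fin n => A) F)
    (a : Fin k → A) (b : Fin n → A) :
    lift₂ k n f (pureTensor k a) (pureTensor n b) = f (Sum.elim a b) := by
  rw [lift₂, ContinuousLinearMap.comp_apply, lift_pureTensor, lift_pureTensor,
    ContinuousMultilinearMap.currySum_apply]

end Lift

/-- Each variable of `K` occurs exactly once in the lists `l 0, …, l (m - 1)`. -/
def OnceEach {K : Type*} {m : ℕ} (l : Fin m → List K) : Prop :=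
  (∀ j, (l j).Nodup) ∧ ∀ k, ∃! j, k ∈ l j

theorem map_prod_of_notMem {K : Type*} [DecidableEq K] (l : List K) (x : K → A) (k : K) (a : A)
    (hk : k ∉ l) : (l.map (Function.update x k a)).prod = (l.map x).prod := by
  congr 1
  exact List.map_congr_left fun i hi => Function.update_of_ne (fun h => hk (by rwa [h] at hi)) _ _

theorem map_prod_update {K : Type*} [DecidableEq K] (p q : List K) (x : K → A) (k : K) (a : A)
    (h : (p ++ k :: q).Nodup) :
    ((p ++ k :: q).map (Function.update x k a)).prod = (p.map x).prod * (a * (q.map x).prod) := by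
  have hp : k ∉ p := fun hk => (List.disjoint_of_nodup_append h) hk List.mem_cons_self
  have hq : k ∉ q := (List.nodup_cons.1 (List.nodup_append.1 h).2.1).1
  rw [List.map_append, List.prod_append, List.map_cons, List.prod_cons, Function.update_self,
    map_prod_of_notMem p x k a hp, map_prod_of_notMem q x k a hq]

theorem blocks_update {K : Type*} [DecidableEq K] {m : ℕ} {l : Fin m → List K} (h : OnceEach l)
    (x : K → A) (k : K) : ∃ (j : Fin m) (b c : A), ∀ a : A,
      (fun i => ((l i).map (Function.update x k a)).prod) =
        Function.update (fun i => ((l i).map x).prod) j (b * (a * c)) := by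
  obtain ⟨j, hj, hu⟩ := h.2 k
  obtain ⟨p, q, hpq⟩ := List.append_of_mem hj
  refine ⟨j, (p.map x).prod, (q.map x).prod, fun a => ?_⟩
  funext i
  by_cases hij : i = j
  · subst hij
    rw [Function.update_self, hpq]
    exact map_prod_update p q x k a (hpq ▸ h.1 i)
  · rw [Function.update_of_ne hij]
    exact map_prod_of_notMem _ _ _ _ fun hk => hij (hu i hk)

/-- The multilinear map sending `x` to `P 0 ⊗ ⋯ ⊗ P (m - 1)`, where `P j` is the ordered product in
`A` of the variables listed in `l j`. -/
def blockProd {K : Type*} {m : ℕ} (l : Fin m → List K) (h : OnceEach l) :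
    ContinuousMultilinearMap ℂ (fun _ : K => A) (TPow A m) where
  toFun x := pureTensor m fun j => ((l j).map x).prod
  map_update_add' x k a a' := by
    obtain ⟨j, b, c, hj⟩ := blocks_update h x k
    rw [hj, hj, hj, add_mul, mul_add, ContinuousMultilinearMap.map_update_add]
  map_update_smul' x k r a := by
    obtain ⟨j, b, c, hj⟩ := blocks_update h x k
    rw [hj, hj, smul_mul_assoc, mul_smul_comm, ContinuousMultilinearMap.map_update_smul]
  cont := (pureTensor m).cont.comp <| continuous_pi fun j =>
    continuous_list_prod (l j) fun k _ => continuous_apply k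

end Tensor

/-! ### Contraction operators -/

section Contraction

variable {m n : ℕ} (f : LForest m n)

/-- The position of the `i`-th letter of the `j`-th block of a word split according to `f`. -/
def LForest.letterPos : (Σ j : Fin m, Fin (f.parts j)) ≃ Fin f.gens :=
  finSigmaFinEquiv.trans (finCongr f.sum_parts)

theorem LForest.sum_leaves : ∑ j, (f.parts j + 1) = n := by
  have h := f.leaves
  simpa [Finset.sum_add_distrib, f.sum_parts] using h

/-- The position, among all the leaves of `f`, of the `i`-th leaf of its `j`-th tree. -/
def LForest.leafPos : (Σ j : Fin m, Fin (f.parts j + 1)) ≃ Fin n :=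
  finSigmaFinEquiv.trans (finCongr f.sum_leaves)

/-- The word `x₀ a₁ x₁ a₂ x₂ ⋯ a_c x_c` in which the letters `a` of the `j`-th block (variables
`Sum.inl`) are interleaved with the arguments `x` at the leaves of the `j`-th tree (variables
`Sum.inr`). -/
def LForest.block (j : Fin m) : List (Fin f.gens ⊕ Fin n) :=
  Sum.inr (f.leafPos ⟨j, 0⟩) :: (List.finRange (f.parts j)).flatMap fun i =>
    [Sum.inl (f.letterPos ⟨j, i⟩), Sum.inr (f.leafPos ⟨j, i.succ⟩)]

theorem LForest.inl_mem_block (j : Fin m) (x : Σ j : Fin m, Fin (f.parts j)) :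
    Sum.inl (f.letterPos x) ∈ f.block j ↔ x.1 = j := by
  obtain ⟨j', i⟩ := x
  simp only [LForest.block, List.mem_cons, List.mem_flatMap, List.mem_finRange, true_and,
    List.not_mem_nil, or_false, reduceCtorEq, false_or, Sum.inl.injEq, EmbeddingLike.apply_eq_iff_eq,
    Sigma.mk.injEq]
  constructor
  · rintro ⟨_, h, _⟩
    exact h
  · rintro rfl
    exact ⟨i, rfl, HEq.rfl⟩

theorem LForest.inr_mem_block (j : Fin m) (x : Σ j : Fin m, Fin (f.parts j + 1)) :
    Sum.inr (f.leafPos x) ∈ f.block j ↔ x.1 = j := by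
  obtain ⟨j', i⟩ := x
  simp only [LForest.block, List.mem_cons, List.mem_flatMap, List.mem_finRange, true_and,
    List.not_mem_nil, or_false, reduceCtorEq, false_or, Sum.inr.injEq, EmbeddingLike.apply_eq_iff_eq,
    Sigma.mk.injEq]
  constructor
  · rintro (⟨h, _⟩ | ⟨_, h, _⟩) <;> exact h
  · rintro rfl
    refine Fin.cases (Or.inl ⟨rfl, HEq.rfl⟩) (fun i => Or.inr ⟨i, rfl, HEq.rfl⟩) i

theorem LForest.block_nodup (j : Fin m) : (f.block j).Nodup := by
  rw [LForest.block, List.nodup_cons]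
  constructor
  · simp [Fin.succ_ne_zero, eq_comm]
  · rw [List.nodup_flatMap]
    refine ⟨fun i _ => by simp, ?_⟩
    refine (List.nodup_finRange _).imp fun {a b} hab => ?_
    simp [hab, eq_comm]

theorem LForest.block_onceEach : OnceEach f.block := by
  refine ⟨f.block_nodup, ?_⟩
  rintro (k | k)
  · obtain ⟨x, rfl⟩ := f.letterPos.surjective k
    exact ⟨x.1, (f.inl_mem_block _ x).2 rfl, fun j hj => ((f.inl_mem_block j x).1 hj).symm⟩
  · obtain ⟨x, rfl⟩ := f.leafPos.surjective k
    exact ⟨x.1, (f.inr_mem_block _ x).2 rfl, fun j hj => ((f.inr_mem_block j x).1 hj).symm⟩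

variable {A : Type*} [CStarAlgebra A]

/-- The representation `Op` on words split according to `f`: the word `a` is sent to the operator
`x ↦ ⨂_j (x_{j,0} · a_{j,1} · x_{j,1} ⋯ a_{j,c_j} · x_{j,c_j})` from the tensors of length `n` to
the tensors of length `m`. -/
def LForest.op : TPow A f.gens →L[ℂ] TPow A n →L[ℂ] TPow A m :=
  lift₂ f.gens n (blockProd f.block f.block_onceEach)

/-- The oriented iterated integral
`∫_s^t dt₁ ∫_s^{t₁} dt₂ ⋯ ∫_s^{t_{k-1}} dt_k  F (t₁, …, t_k)`; for `s ≤ t` this is the integral of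
`F` over the simplex `t > t₁ > ⋯ > t_k > s`. -/
def iterInt {E : Type*} [NormedAddCommGroup E] [NormedSpace ℝ E] :
    (k : ℕ) → ((Fin k → ℝ) → E) → ℝ → ℝ → E
  | 0, F, _, _ => F Fin.elim0
  | k + 1, F, s, t => ∫ r in s..t, iterInt k (fun u => F (Fin.cons r u)) s r

/-- The iterated integral `∫ dX_{t_{σ(1)}} ⊗ ⋯ ⊗ dX_{t_{σ(k)}}` over the simplex between `s` and
`t`. -/
def iterTensor (X : ℝ → A) {k : ℕ} (σ : Equiv.Perm (Fin k)) (s t : ℝ) : TPow A k :=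
  iterInt k (fun u => pureTensor k fun i => derivWithin X (Set.Icc 0 1) (u (σ i))) s t

/-- The partial contraction operator of the path `X` along the levelled forest `f`. -/
def contraction (X : ℝ → A) (s t : ℝ) : TPow A n →L[ℂ] TPow A m :=
  f.op (iterTensor X f.perm s t)

end Contraction

/-! ### The algebra `LT♯(A)`, the endomorphisms of a path and the group `G(A)` -/

section Algebra

/-- The variables of the product `(A₀ ⊗ ⋯ ⊗ A_n) · (B₀ ⊗ ⋯ ⊗ B_m)`: the last letter of the first
word is multiplied by the first letter of the second one. -/
def mergeBlock (n m : ℕ) (j : Fin (n + m + 1)) : List (Fin (n + 1) ⊕ Fin (m + 1)) :=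
  (if h : (j : ℕ) < n + 1 then [Sum.inl ⟨j, h⟩] else []) ++
    (if n ≤ (j : ℕ) then [Sum.inr ⟨j - n, by omega⟩] else [])

theorem mergeBlock_onceEach (n m : ℕ) : OnceEach (mergeBlock n m) := by
  constructor
  · intro j
    unfold mergeBlock
    split_ifs <;> simp
  · rintro (k | k)
    · refine ⟨⟨k, by omega⟩, ?_, fun j hj => ?_⟩
      · simp [mergeBlock, Fin.is_le]
      · simp only [mergeBlock] at hj
        split_ifs at hj <;> simp_all [Fin.ext_iff]
    · refine ⟨⟨n + k, by omega⟩, ?_, fun j hj => ?_⟩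
      · simp [mergeBlock]
      · simp only [mergeBlock] at hj
        split_ifs at hj <;> simp_all [Fin.ext_iff]

variable (A : Type*) [CStarAlgebra A]

/-- The space `LT♯(A)`: the direct sum over all levelled trees `τ` of one copy of the projective
tensor power of `A` of order the number of leaves of `τ`. -/
abbrev LTA : Type _ := ⨁ τ : LTree, TPow A (τ.1 + 1)

variable {A}

/-- The element `a τ` of `LT♯(A)`, linearly in `a`. -/
def single (τ : LTree) : TPow A (τ.1 + 1) →ₗ[ℂ] LTA A :=
  DirectSum.lof ℂ LTree (fun τ => TPow A (τ.1 + 1)) τ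

/-- The component `LT♯(A)(τ)` of `LT♯(A)`. -/
def component (τ : LTree) : Submodule ℂ (LTA A) := LinearMap.range (single τ)

/-- The product `(A₀ ⊗ ⋯ ⊗ A_n) · (B₀ ⊗ ⋯ ⊗ B_m) = A₀ ⊗ ⋯ ⊗ (A_n · B₀) ⊗ ⋯ ⊗ B_m`. -/
def merge (n m : ℕ) : TPow A (n + 1) →L[ℂ] TPow A (m + 1) →L[ℂ] TPow A (n + m + 1) :=
  lift₂ (n + 1) (m + 1) (blockProd (mergeBlock n m) (mergeBlock_onceEach n m))

/-- The shuffle product of `LT♯(A)`: `(a α) ⧢ (b β) = ∑ (a · b) (s ∘ (α ⊗ β))`, the sum being over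
all shuffles `s` of the generations of `α` and `β`. -/
def shuffle : LTA A →ₗ[ℂ] LTA A →ₗ[ℂ] LTA A :=
  DirectSum.toModule ℂ LTree (LTA A →ₗ[ℂ] LTA A) fun α =>
    LinearMap.flip <| DirectSum.toModule ℂ LTree (TPow A (α.1 + 1) →ₗ[ℂ] LTA A) fun β =>
      LinearMap.flip <| ∑ s ∈ shuffles α.1 β.1,
        LinearMap.mk₂ ℂ
          (fun a b => single (A := A) ⟨α.1 + β.1, s * shiftedConcat α.2 β.2⟩ (merge α.1 β.1 a b))
          (fun _ _ _ => by simp) (fun _ _ _ => by simp)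
          (fun _ _ _ => by simp) (fun _ _ _ => by simp)

/-- The unit `1 •` of the shuffle product. -/
def shuffleOne : LTA A := single LTree.root (pureTensor 1 fun _ => 1)

/-- `φ` is an endomorphism of the unital algebra `(LT♯(A), ⧢)`. -/
structure IsAlgEndo (φ : LTA A →ₗ[ℂ] LTA A) : Prop where
  map_one : φ shuffleOne = shuffleOne
  map_shuffle : ∀ x y, φ (shuffle x y) = shuffle (φ x) (φ y)

variable (A) in
/-- The set `G(A)` of the endomorphisms of the algebra `LT♯(A)` which differ from the identity, on
each component `LT♯(A)(τ)`, by terms in the components of the proper subtrees of `τ`. -/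
def G : Set (Module.End ℂ (LTA A)) :=
  {φ | IsAlgEndo φ ∧ ∀ τ : LTree, ∀ x ∈ component (A := A) τ,
    φ x - x ∈ ⨆ (τ' : LTree) (_ : τ'.IsSubtree τ ∧ τ' ≠ τ), component (A := A) τ'}

/-- The endomorphism `a τ ↦ ∑_{τ' ⊆ τ} 𝕏^{τ \ τ'}_{s,t}(a) τ'` associated with the path `X`. -/
def pathEndo (X : ℝ → A) (s t : ℝ) : Module.End ℂ (LTA A) :=
  DirectSum.toModule ℂ LTree (LTA A) fun τ =>
    ∑ p : Fin (τ.1 + 1),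
      single (τ.lower p) ∘ₗ (contraction (τ.upper p) X s t).toLinearMap

end Algebra

end

end LevelledSignature

namespace LevelledSignature

noncomputable section

/-! ### Positions of the low and high letters of a word -/

/-! Everything follows from one linear differential equation. Let `x` be the velocity of the path.
Differentiating an integral over t > t₁ > ⋯ > t_N > s in t sets t₁ = t. The time t₁ is attached to
the lowest generation of τ \ τ', which is also the top generation of the next larger subtree. Hence
V(t), the image of v under the endomorphism for (s, t), satisfies V' = `topContr (x t)` V and V(s) =
v (`hasCoordDerivAt_flow`), where `topContr` contracts the top generation of a tree. The algebraic
input is `single_op_op`: contractions along nested cuts compose, which is associativity of the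
product of `A` once the positions of the cuts are known.

The equation is triangular. `topContr` lowers the number of generations by exactly one and V stays
in finitely many components, so a solution vanishing at one time vanishes identically
(`eq_zero_of_hasCoordDerivAt`). Two consequences follow. Chen's relation (`flow_comp`): both sides
solve the equation in t and agree at t = u. Multiplicativity (`flow_shuffle`): `topContr` is a
derivation of the shuffle product (`topContr_shuffle`), so the product of two solutions is a
solution. The derivation property holds because the largest value of a shuffle is taken at the end
of one of its two increasing runs, that is, at the top generation of one of the two factors.

The group property is separate: an element of `G A` is unitriangular for the subtree order, and
proper subtrees have fewer generations, so inverses are handled by induction on that number.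

Contractions and products are continuous, so identities are checked on pure tensors. These are
written with sequences `ℕ → A`, which keeps the arithmetic of leaves in `ℕ`. -/

theorem orderEmbOfFin_lt_iff {n k : ℕ} (s : Finset (Fin n)) (h : s.card = k) (i : Fin n)
    (r : Fin k) : s.orderEmbOfFin h r < i ↔ (r : ℕ) < (s.filter (· < i)).card := by
  have hc : (s.filter (· < i)).card =
      (Finset.univ.filter fun q : Fin k => s.orderEmbOfFin h q < i).card := by
    rw [← Finset.card_map (s.orderEmbOfFin h).toEmbedding]
    congr 1
    ext j
    simp only [Finset.mem_filter, Finset.mem_map, Finset.mem_univ, true_and]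
    constructor
    · rintro ⟨hj, hji⟩
      have : j ∈ Set.range (s.orderEmbOfFin h) := by
        rw [Finset.range_orderEmbOfFin]; exact hj
      obtain ⟨q, rfl⟩ := this
      exact ⟨q, hji, rfl⟩
    · rintro ⟨q, hq, rfl⟩
      exact ⟨s.orderEmbOfFin_mem h q, hq⟩
  rw [hc]
  constructor
  · intro hr
    have : Finset.Iic r ⊆ Finset.univ.filter fun q : Fin k => s.orderEmbOfFin h q < i := by
      intro q hq
      rw [Finset.mem_Iic] at hq
      simp only [Finset.mem_filter, Finset.mem_univ, true_and]
      exact ((s.orderEmbOfFin h).monotone hq).trans_lt hr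
    have h2 := Finset.card_le_card this
    rw [Fin.card_Iic] at h2
    omega
  · intro hr
    by_contra hcon
    have : (Finset.univ.filter fun q : Fin k => s.orderEmbOfFin h q < i) ⊆ Finset.Iio r := by
      intro q hq
      simp only [Finset.mem_filter, Finset.mem_univ, true_and] at hq
      rw [Finset.mem_Iio]
      by_contra hqr
      exact hcon (((s.orderEmbOfFin h).monotone (not_lt.1 hqr)).trans_lt hq)
    have h2 := Finset.card_le_card this
    rw [Fin.card_Iio] at h2
    omega

theorem card_filter_lt_orderEmbOfFin {n k : ℕ} (s : Finset (Fin n)) (h : s.card = k)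
    (r : Fin k) : (s.filter (· < s.orderEmbOfFin h r)).card = r := by
  have hle : (s.filter (· < s.orderEmbOfFin h r)).card ≤ k := (Finset.card_filter_le _ _).trans h.le
  have h1 := (orderEmbOfFin_lt_iff s h (s.orderEmbOfFin h r) r).not.1 (lt_irrefl _)
  by_contra hne
  have hlt : (s.filter (· < s.orderEmbOfFin h r)).card < r := by omega
  have h2 := (orderEmbOfFin_lt_iff s h (s.orderEmbOfFin h r)
    ⟨(s.filter (· < s.orderEmbOfFin h r)).card, by omega⟩).1
    ((s.orderEmbOfFin h).strictMono (Fin.lt_def.2 hlt))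
  exact absurd h2 (lt_irrefl _)

section Cut

variable {n : ℕ} (σ : Equiv.Perm (Fin n)) (p : Fin (n + 1))

/-- The first leaf of the `j`-th tree of the forest above the horizontal cut of `σ` at level `p`;
beyond the last tree the sequence goes on with step one from the number of leaves. -/
def cut : ℕ → ℕ
  | 0 => 0
  | j + 1 => if h : j < p then (lowEmb σ p ⟨j, h⟩ : ℕ) + 1 else n + 1 + (j - p)

theorem cut_succ_of_lt {j : ℕ} (h : j < p) : cut σ p (j + 1) = (lowEmb σ p ⟨j, h⟩ : ℕ) + 1 := by
  simp [cut, h]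

theorem cut_succ_of_le {j : ℕ} (h : (p : ℕ) ≤ j) : cut σ p (j + 1) = n + 1 + (j - p) := by
  simp [cut, not_lt.2 h]

/-- The artificial continuation of `cut` beyond the last tree serves this statement: monotonicity on
all of `ℕ` lets indices be compared, and `seg_comp` be applied, without range conditions. -/
theorem cut_strictMono : StrictMono (cut σ p) := by
  refine strictMono_nat_of_lt_succ fun j => ?_
  rcases j with _ | j
  · simp only [cut]
    split_ifs <;> omega
  · rcases lt_trichotomy (j + 1) (p : ℕ) with h | h | h
    · rw [cut_succ_of_lt σ p h, cut_succ_of_lt σ p (by omega : j < p)]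
      have : lowEmb σ p ⟨j, by omega⟩ < lowEmb σ p ⟨j + 1, h⟩ :=
        (lowEmb σ p).strictMono (Fin.lt_def.2 (Nat.lt_succ_self j))
      rw [Fin.lt_def] at this
      omega
    · rw [cut_succ_of_le σ p h.ge, cut_succ_of_lt σ p (by omega : j < p)]
      omega
    · rw [cut_succ_of_le σ p h.le, cut_succ_of_le σ p (by omega : (p : ℕ) ≤ j)]
      omega

theorem mem_lowPos {i : Fin n} : i ∈ lowPos σ p ↔ (σ i : ℕ) < p := by simp [lowPos]

theorem mem_highPos {i : Fin n} : i ∈ highPos σ p ↔ (p : ℕ) ≤ σ i := by simp [highPos]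

theorem exists_lowEmb_eq {i : Fin n} (h : (σ i : ℕ) < p) : ∃ k, lowEmb σ p k = i := by
  have : i ∈ Set.range ((lowPos σ p).orderEmbOfFin (card_lowPos σ p)) := by
    rw [Finset.range_orderEmbOfFin]; exact (mem_lowPos σ p).2 h
  exact this

theorem exists_highEmb_eq {i : Fin n} (h : (p : ℕ) ≤ σ i) : ∃ k, highEmb σ p k = i := by
  have : i ∈ Set.range ((highPos σ p).orderEmbOfFin (card_highPos σ p)) := by
    rw [Finset.range_orderEmbOfFin]; exact (mem_highPos σ p).2 h
  exact this

/-- The high letters lying above the `j`-th tree are those in the `j`-th block of leaves. -/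
theorem high_and_card_iff (j : Fin ((p : ℕ) + 1)) (i : Fin n) :
    ((p : ℕ) ≤ σ i ∧ ((lowPos σ p).filter (· < i)).card = j) ↔
      cut σ p j ≤ i ∧ (i : ℕ) + 1 < cut σ p (j + 1) := by
  have hk : ∀ k : Fin p, lowEmb σ p k < i ↔ (k : ℕ) < ((lowPos σ p).filter (· < i)).card :=
    orderEmbOfFin_lt_iff _ (card_lowPos σ p) i
  have hle : ((lowPos σ p).filter (· < i)).card ≤ p :=
    (Finset.card_filter_le _ _).trans (card_lowPos σ p).le
  obtain ⟨j, hj⟩ := j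
  simp only
  constructor
  · rintro ⟨hi, hc⟩
    constructor
    · rcases j with _ | j
      · simp [cut]
      · rw [cut_succ_of_lt σ p (by omega : j < p)]
        have := (hk ⟨j, by omega⟩).2 (by simp only; omega)
        rw [Fin.lt_def] at this
        omega
    · by_cases hjp : j < p
      · rw [cut_succ_of_lt σ p hjp]
        have h1 := (hk ⟨j, hjp⟩).not.2 (by simp only; omega)
        have h2 : lowEmb σ p ⟨j, hjp⟩ ≠ i := by
          rintro rfl
          have := lt_of_lowEmb σ p ⟨j, hjp⟩
          omega
        have h3 := lt_of_le_of_ne (not_lt.1 h1) h2.symm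
        rw [Fin.lt_def] at h3
        omega
      · rw [cut_succ_of_le σ p (by omega : (p : ℕ) ≤ j)]
        omega
  · rintro ⟨h1, h2⟩
    constructor
    · by_contra hlow
      obtain ⟨k, rfl⟩ := exists_lowEmb_eq σ p (not_le.1 hlow)
      have h3 : cut σ p (k + 1) = (lowEmb σ p k : ℕ) + 1 := cut_succ_of_lt σ p k.2
      rw [← h3] at h2
      have h4 := (cut_strictMono σ p).lt_iff_lt.1 h2
      have h5 : cut σ p j < cut σ p (k + 1) := by omega
      have h6 := (cut_strictMono σ p).lt_iff_lt.1 h5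
      omega
    · apply le_antisymm
      · by_contra hcon
        have hlt := not_le.1 hcon
        have h3 := (hk ⟨j, by omega⟩).2 hlt
        rw [cut_succ_of_lt σ p (by omega : j < p)] at h2
        rw [Fin.lt_def] at h3
        omega
      · rcases j with _ | j
        · omega
        · rw [cut_succ_of_lt σ p (by omega : j < p)] at h1
          exact (hk ⟨j, by omega⟩).1 (Fin.lt_def.2 (by omega))

theorem cut_le (j : ℕ) (hj : j ≤ p + 1) : cut σ p j ≤ n + 1 := by
  have h := (cut_strictMono σ p).monotone hj
  rw [cut_succ_of_le σ p le_rfl] at h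
  omega

/-- A tree with c internal vertices occupies c + 1 consecutive leaves, and its vertices lie between
them; hence the interval of vertices is one shorter than that of leaves. -/
theorem cut_add_gapParts (j : Fin ((p : ℕ) + 1)) :
    cut σ p j + (gapParts σ p j + 1) = cut σ p (j + 1) := by
  have h1 : gapParts σ p j = (Finset.Ico (cut σ p j) (cut σ p (j + 1) - 1)).card := by
    rw [gapParts, ← Finset.card_map Fin.valEmbedding]
    congr 1
    ext i
    simp only [Finset.mem_map, Finset.mem_filter, Fin.valEmbedding_apply, Finset.mem_Ico,
      mem_highPos]
    constructor
    · rintro ⟨k, hk, rfl⟩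
      have := (high_and_card_iff σ p j k).1 hk
      omega
    · intro hi
      have h2 := cut_le σ p (j + 1) (by omega)
      exact ⟨⟨i, by omega⟩, (high_and_card_iff σ p j ⟨i, by omega⟩).2 ⟨hi.1, by simp only; omega⟩, rfl⟩
  have h2 : cut σ p j < cut σ p (j + 1) := cut_strictMono σ p (Nat.lt_succ_self _)
  rw [h1, Nat.card_Ico]
  omega

theorem sum_gapParts_add_one (j : ℕ) (hj : j ≤ p + 1) :
    ∑ i : Fin j, (gapParts σ p (Fin.castLE hj i) + 1) = cut σ p j := by
  induction j with
  | zero => simp [cut]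
  | succ j ih =>
    rw [Fin.sum_univ_castSucc]
    have h1 := ih (by omega)
    have h2 := cut_add_gapParts σ p ⟨j, by omega⟩
    simp only at h2
    rw [← h2, ← h1]
    rfl

theorem leafPos_upper (τ : LTree) (p : Fin (τ.1 + 1)) (j : Fin ((p : ℕ) + 1))
    (i : Fin (gapParts τ.2 p j + 1)) :
    ((τ.upper p).leafPos ⟨j, i⟩ : ℕ) = cut τ.2 p j + i := by
  rw [← sum_gapParts_add_one τ.2 p j (by omega)]
  exact finSigmaFinEquiv_apply (m := (p : ℕ) + 1) (n := fun j => gapParts τ.2 p j + 1) ⟨j, i⟩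

/-- The position `cut σ p j + i` has exactly `j` low letters before it, so its rank among the high
letters is `cut σ p j + i - j`. This is the index that `letterPos` assigns to the `i`-th letter of
the `j`-th block. -/
theorem highEmb_letterPos_upper (τ : LTree) (p : Fin (τ.1 + 1)) (j : Fin ((p : ℕ) + 1))
    (i : Fin (gapParts τ.2 p j)) :
    (highEmb τ.2 p ((τ.upper p).letterPos ⟨j, i⟩) : ℕ) = cut τ.2 p j + i := by
  obtain ⟨n, σ⟩ := τ
  change Fin (n + 1) at p
  change Fin (gapParts σ p j) at i
  simp only
  have h1 : ((LTree.upper ⟨n, σ⟩ p).letterPos ⟨j, i⟩ : ℕ) =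
      ∑ k : Fin j, gapParts σ p (Fin.castLE (by omega) k) + i :=
    finSigmaFinEquiv_apply (m := (p : ℕ) + 1) (n := fun j => gapParts σ p j) ⟨j, i⟩
  have h2 := sum_gapParts_add_one σ p j (by omega)
  rw [Finset.sum_add_distrib] at h2
  simp only [Finset.sum_const, Finset.card_univ, Fintype.card_fin, smul_eq_mul, mul_one] at h2
  have h3 := cut_add_gapParts σ p j
  have h4 := cut_le σ p (j + 1) (by omega)
  have hi := i.2
  have hlt : cut σ p j + i < n := by omega
  obtain ⟨h5, h6⟩ := (high_and_card_iff σ p j ⟨cut σ p j + i, hlt⟩).2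
    ⟨by simp only; omega, by simp only; omega⟩
  obtain ⟨k, hk⟩ := exists_highEmb_eq σ p h5
  have h7 : ((highPos σ p).filter (· < highEmb σ p k)).card = k :=
    card_filter_lt_orderEmbOfFin _ (card_highPos σ p) k
  rw [hk] at h7
  -- Every earlier position is either high or low, so the two counts add up to the position itself.
  have h8 : ((highPos σ p).filter (· < (⟨cut σ p j + i, hlt⟩ : Fin n))).card +
      ((lowPos σ p).filter (· < (⟨cut σ p j + i, hlt⟩ : Fin n))).card = cut σ p j + i := by
    rw [← Finset.card_union_of_disjoint]
    · rw [← Finset.filter_union]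
      have : highPos σ p ∪ lowPos σ p = Finset.univ := by
        ext x
        simp only [Finset.mem_union, mem_highPos, mem_lowPos, Finset.mem_univ, iff_true]
        omega
      rw [this]
      rw [Finset.filter_gt_eq_Iio, Fin.card_Iio]
    · rw [Finset.disjoint_left]
      intro x hx hx'
      rw [Finset.mem_filter, mem_highPos] at hx
      rw [Finset.mem_filter, mem_lowPos] at hx'
      omega
  have h9 : (LTree.upper ⟨n, σ⟩ p).letterPos ⟨j, i⟩ = k := by
    apply Fin.ext
    rw [h1]
    omega
  rw [h9]
  change (highEmb σ p k : ℕ) = _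
  rw [hk]

/-- Both sides enumerate increasingly the positions of the `p` smallest letters, and such an
enumeration is unique. -/
theorem lowEmb_comp (q : Fin (n + 1)) (p : Fin ((q : ℕ) + 1)) (p' : Fin (n + 1))
    (h : (p' : ℕ) = p) (k : ℕ) (hk : k < p) :
    lowEmb σ q (lowEmb (lowWord σ q) p ⟨k, hk⟩) = lowEmb σ p' ⟨k, h ▸ hk⟩ := by
  have := (lowPos σ p').orderEmbOfFin_unique (card_lowPos σ p')
    (f := fun r : Fin p' => lowEmb σ q (lowEmb (lowWord σ q) p (Fin.cast h r)))
    (fun r => by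
      rw [mem_lowPos]
      exact (lt_of_lowEmb (lowWord σ q) p (Fin.cast h r)).trans_eq h.symm)
    (fun r r' hr => (lowEmb σ q).strictMono ((lowEmb (lowWord σ q) p).strictMono hr))
  exact congrFun this ⟨k, h ▸ hk⟩

theorem cut_comp (q : Fin (n + 1)) (p : Fin ((q : ℕ) + 1)) (p' : Fin (n + 1))
    (h : (p' : ℕ) = p) (j : ℕ) (hj : j ≤ p + 1) :
    cut σ q (cut (lowWord σ q) p j) = cut σ p' j := by
  rcases j with _ | j
  · simp [cut]
  · rcases lt_or_ge j (p : ℕ) with hjp | hjp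
    · rw [cut_succ_of_lt _ _ hjp, cut_succ_of_lt _ _ (h ▸ hjp : j < p'),
        cut_succ_of_lt _ _ (Fin.is_lt _), ← lowEmb_comp σ q p p' h j hjp]
    · have : j = p := by omega
      subst this
      rw [cut_succ_of_le _ _ le_rfl, cut_succ_of_le _ _ h.le, Nat.sub_self, add_zero,
        cut_succ_of_le _ _ le_rfl, h]
      omega

end Cut

/-! ### Interleaved products -/

section Seg

variable {A : Type*} [CStarAlgebra A]

/-- The interleaved product `a b * z b * a (b + 1) * ⋯ * z (b + k - 1) * a (b + k)`. -/
def seg (a z : ℕ → A) (b : ℕ) : ℕ → A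
  | 0 => a b
  | k + 1 => seg a z b k * z (b + k) * a (b + k + 1)

theorem seg_congr {a a' z z' : ℕ → A} {b k : ℕ} (ha : ∀ i, b ≤ i → i ≤ b + k → a i = a' i)
    (hz : ∀ i, b ≤ i → i < b + k → z i = z' i) : seg a z b k = seg a' z' b k := by
  induction k with
  | zero => exact ha b le_rfl le_rfl
  | succ k ih =>
    rw [seg, seg, ih (fun i h1 h2 => ha i h1 (by omega)) (fun i h1 h2 => hz i h1 (by omega)),
      hz _ (by omega) (by omega), ha _ (by omega) (by omega)]

theorem seg_append (a z : ℕ → A) (b k l : ℕ) :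
    seg a z b (k + l + 1) = seg a z b k * z (b + k) * seg a z (b + k + 1) l := by
  induction l with
  | zero => rfl
  | succ l ih =>
    rw [show k + (l + 1) + 1 = (k + l + 1) + 1 by omega, seg, ih, seg]
    simp only [mul_assoc]
    rw [show b + (k + l + 1) = b + k + 1 + l by omega]

/-- This is associativity: grouping a long interleaved product into consecutive blocks separated by
the elements at positions `c (j + 1) - 1` does not change it. -/
theorem seg_comp (a z : ℕ → A) {c : ℕ → ℕ} (hc : StrictMono c) (b k : ℕ) :
    seg (fun j => seg a z (c j) (c (j + 1) - c j - 1)) (fun j => z (c (j + 1) - 1)) b k =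
      seg a z (c b) (c (b + k + 1) - c b - 1) := by
  induction k with
  | zero => rfl
  | succ k ih =>
    rw [seg, ih]
    have h1 : c b < c (b + k + 1) := hc (by omega)
    have h2 : c (b + k + 1) < c (b + k + 1 + 1) := hc (by omega)
    have h3 := seg_append a z (c b) (c (b + k + 1) - c b - 1)
      (c (b + k + 1 + 1) - c (b + k + 1) - 1)
    rw [show c b + (c (b + k + 1) - c b - 1) = c (b + k + 1) - 1 by omega,
      show c (b + k + 1) - 1 + 1 = c (b + k + 1) by omega] at h3
    rw [← h3, show b + (k + 1) + 1 = b + k + 1 + 1 by omega]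
    congr 1
    omega

theorem prod_interleave (a z : ℕ → A) (b c : ℕ) :
    a b * ((List.finRange c).flatMap fun i : Fin c => [z (b + i), a (b + i + 1)]).prod =
      seg a z b c := by
  induction c with
  | zero => simp [seg]
  | succ c ih =>
    rw [List.finRange_succ_last, List.flatMap_append, List.prod_append, ← mul_assoc,
      List.flatMap_map]
    simp only [Fin.val_castSucc]
    rw [ih]
    simp [seg, mul_assoc]

variable {n : ℕ}

/-- The element inserted at the successive positions of the word `σ`, when `y l` is the element
associated with the level `l`. -/
def letters (σ : Equiv.Perm (Fin n)) (y : ℕ → A) (i : ℕ) : A :=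
  if h : i < n then y (σ ⟨i, h⟩) else 1

/-- The leaves remaining after the contraction of the leaves `a` of the tree `σ` with the elements
`y l` at the levels `l ≥ p`. -/
def contr (σ : Equiv.Perm (Fin n)) (p : Fin (n + 1)) (y a : ℕ → A) (j : ℕ) : A :=
  seg a (letters σ y) (cut σ p j) (cut σ p (j + 1) - cut σ p j - 1)

/-- The blocks of the cut at `p` of the lower tree are unions of blocks of the cut at `q`
(`cut_comp`), so `seg_comp` merges the two contractions. -/
theorem contr_comp (σ : Equiv.Perm (Fin n)) (q : Fin (n + 1)) (p : Fin ((q : ℕ) + 1))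
    (p' : Fin (n + 1)) (h : (p' : ℕ) = p) (y a : ℕ → A) (j : ℕ) (hj : j ≤ p) :
    contr (lowWord σ q) p y (contr σ q y a) j = contr σ p' y a j := by
  have h1 := cut_comp σ q p p' h j (by omega)
  have h2 := cut_comp σ q p p' h (j + 1) (by omega)
  have h3 := cut_strictMono (lowWord σ q) p (Nat.lt_succ_self j)
  have h4 := cut_le (lowWord σ q) p (j + 1) (by omega)
  have h5 := seg_comp a (letters σ y) (cut_strictMono σ q) (cut (lowWord σ q) p j)
    (cut (lowWord σ q) p (j + 1) - cut (lowWord σ q) p j - 1)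
  rw [show cut (lowWord σ q) p j + (cut (lowWord σ q) p (j + 1) - cut (lowWord σ q) p j - 1) + 1
    = cut (lowWord σ q) p (j + 1) by simp only [Nat.succ_eq_add_one] at h3; omega, h1, h2] at h5
  rw [contr, contr, ← h5]
  refine seg_congr (fun i _ _ => rfl) fun i hi1 hi2 => ?_
  -- The letter separating blocks `i` and `i + 1` of the cut at `q` sits at position `cut σ q (i +
  -- 1) - 1 = lowEmb σ q i`, so it carries the `i`-th level of the lower word.
  have hiq : i < (q : ℕ) := by omega
  have h6 := cut_succ_of_lt σ q hiq
  simp only [letters, hiq, h6, dif_pos, Nat.add_sub_cancel, Fin.is_lt, Fin.eta]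
  rfl

theorem pureTensor_congr {n : ℕ} {a a' : ℕ → A} (h : ∀ i < n, a i = a' i) :
    pureTensor n (fun i : Fin n => a i) = pureTensor n (fun i : Fin n => a' i) :=
  congrArg _ (funext fun i => h i i.2)

theorem LForest.prod_map_block {m n : ℕ} (f : LForest m n) (j : Fin m)
    (v : Fin f.gens ⊕ Fin n → A) : ((f.block j).map v).prod = v (Sum.inr (f.leafPos ⟨j, 0⟩)) *
      ((List.finRange (f.parts j)).flatMap fun i =>
        [v (Sum.inl (f.letterPos ⟨j, i⟩)), v (Sum.inr (f.leafPos ⟨j, i.succ⟩))]).prod := by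
  rw [LForest.block, List.map_cons, List.prod_cons, List.map_flatMap]
  rfl

/-- The inserted elements are indexed by levels of the whole tree rather than of the forest, so that
one family `y` serves all cuts of `τ` simultaneously. -/
theorem op_upper_pureTensor (τ : LTree) (p : Fin (τ.1 + 1)) (y a : ℕ → A)
    (w : Fin (τ.1 - p) → A) (hw : ∀ i, w i = y (p + highWord τ.2 p i)) :
    (τ.upper p).op (pureTensor (τ.1 - p) w) (pureTensor (τ.1 + 1) fun i => a i) =
      pureTensor ((p : ℕ) + 1) fun j => contr τ.2 p y a j := by
  refine (lift₂_pureTensor (k := τ.1 - p) (n := τ.1 + 1) _ w fun i => a i).trans ?_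
  refine congrArg (pureTensor ((p : ℕ) + 1)) (funext fun j => ?_)
  refine ((τ.upper p).prod_map_block j _).trans ?_
  have hl : cut τ.2 p (j + 1) - cut τ.2 p j - 1 = gapParts τ.2 p j := by
    have := cut_add_gapParts τ.2 p j
    omega
  rw [contr, hl, ← prod_interleave]
  refine congrArg₂ (· * ·) (congrArg a (leafPos_upper τ p j 0)) (congrArg List.prod ?_)
  refine List.flatMap_congr fun i _ => ?_
  have h1 := highEmb_letterPos_upper τ p j i
  refine congrArg₂ (fun b c : A => [b, c]) ?_ (congrArg a (leafPos_upper τ p j i.succ))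
  refine (hw ((τ.upper p).letterPos ⟨j, i⟩)).trans ?_
  have h3 := le_of_highEmb τ.2 p ((τ.upper p).letterPos ⟨j, i⟩)
  rw [letters, dif_pos (h1.symm.trans_lt (Fin.is_lt _))]
  refine congrArg y ((Nat.add_sub_cancel' h3).trans ?_)
  exact congrArg (fun l : Fin τ.1 => (τ.2 l : ℕ)) (Fin.ext h1)

end Seg

/-! ### Reduction to pure tensors -/

section Density

variable {A : Type*} [CStarAlgebra A]

/-- Pure tensors span the algebraic tensor power, which is dense in its completion. -/
theorem tpow_ext {n : ℕ} {F : Type*} [NormedAddCommGroup F] [NormedSpace ℂ F]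
    {f g : TPow A n →L[ℂ] F}
    (h : ∀ a : ℕ → A, f (pureTensor n fun i : Fin n => a i) = g (pureTensor n fun i : Fin n => a i)) :
    f = g := by
  have h' : ∀ a : Fin n → A, f (pureTensor n a) = g (pureTensor n a) := by
    intro a
    -- Only the first `n` values matter; the value 1 beyond them is arbitrary.
    have := h fun i => if hi : i < n then a ⟨i, hi⟩ else 1
    simpa using this
  have key : ∀ x : UniformSpace.Completion (⨂[ℂ] _ : Fin n, A), f x = g x := by
    intro x
    induction x using UniformSpace.Completion.induction_on with
    | hp => exact isClosed_eq f.continuous g.continuous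
    | ih x =>
      have : f.toLinearMap ∘ₗ (UniformSpace.Completion.toComplL (𝕜 := ℂ)
            (E := ⨂[ℂ] _ : Fin n, A)).toLinearMap =
          g.toLinearMap ∘ₗ (UniformSpace.Completion.toComplL (𝕜 := ℂ)
            (E := ⨂[ℂ] _ : Fin n, A)).toLinearMap :=
        PiTensorProduct.ext (MultilinearMap.ext fun a => h' a)
      exact LinearMap.congr_fun this x
  exact ContinuousLinearMap.ext key

theorem single_apply_self (τ : LTree) (a : TPow A (τ.1 + 1)) : single τ a τ = a :=
  DirectSum.of_eq_same _ _

theorem single_apply_of_ne {τ τ' : LTree} (h : τ' ≠ τ) (a : TPow A (τ.1 + 1)) :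
    single τ a τ' = 0 :=
  DirectSum.of_eq_of_ne _ _ _ h

theorem single_injective (τ : LTree) : Function.Injective (single (A := A) τ) := fun a b h => by
  rw [← single_apply_self τ a, ← single_apply_self τ b, h]

theorem lta_induction {p : LTA A → Prop} (h0 : p 0) (hs : ∀ τ a, p (single τ a))
    (ha : ∀ v w, p v → p w → p (v + w)) (v : LTA A) : p v :=
  DirectSum.induction_on v h0 hs ha

theorem end_ext {V : Type*} [AddCommMonoid V] [Module ℂ V] {f g : LTA A →ₗ[ℂ] V}
    (h : ∀ τ a, f (single τ a) = g (single τ a)) : f = g :=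
  DirectSum.linearMap_ext ℂ fun τ => LinearMap.ext (h τ)

/-- The coordinate of `LT♯(A)` at a tree. -/
def coord (τ : LTree) : LTA A →ₗ[ℂ] TPow A (τ.1 + 1) := DirectSum.component ℂ LTree _ τ

/-- The coordinate at `τ'` of `single τ`, as a continuous linear map. -/
def singleCoord (τ τ' : LTree) : TPow A (τ.1 + 1) →L[ℂ] TPow A (τ'.1 + 1) where
  toLinearMap := coord τ' ∘ₗ single τ
  cont := by
    by_cases h : τ' = τ
    · subst h
      have : ⇑(coord τ' ∘ₗ single (A := A) τ') = id := funext fun a => single_apply_self τ' a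
      exact (continuous_congr (congrFun this)).2 continuous_id
    · have : ⇑(coord τ' ∘ₗ single (A := A) τ) = fun _ => 0 :=
        funext fun a => single_apply_of_ne h a
      exact (continuous_congr (congrFun this)).2 continuous_const

theorem continuous_single_apply {T : Type*} [TopologicalSpace T] (τ τ' : LTree)
    {f : T → TPow A (τ.1 + 1)} (hf : Continuous f) : Continuous fun t => single τ (f t) τ' :=
  (singleCoord τ τ').continuous.comp hf

/-- Two linear maps from a tensor power to `LT♯(A)` with continuous coordinates agree if they agree
on pure tensors. -/
theorem lta_ext_pureTensor {n : ℕ} {f g : TPow A n →ₗ[ℂ] LTA A}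
    (hf : ∀ τ, Continuous fun a => f a τ) (hg : ∀ τ, Continuous fun a => g a τ)
    (h : ∀ a : ℕ → A, f (pureTensor n fun i : Fin n => a i) = g (pureTensor n fun i : Fin n => a i)) :
    f = g := by
  refine LinearMap.ext fun a => DFinsupp.ext fun τ => ?_
  have := tpow_ext (f := (⟨coord τ ∘ₗ f, hf τ⟩ : TPow A n →L[ℂ] TPow A (τ.1 + 1)))
    (g := ⟨coord τ ∘ₗ g, hg τ⟩) fun a => congrArg (coord τ) (h a)
  exact DFunLike.congr_fun this a

end Density

/-! ### Nested contractions and contraction of the top generation -/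

section Node

variable {A : Type*} [CStarAlgebra A]

/-- The element `(a 0 ⊗ ⋯ ⊗ a n) σ` of `LT♯(A)`. -/
def node (n : ℕ) (σ : Equiv.Perm (Fin n)) (a : ℕ → A) : LTA A :=
  single ⟨n, σ⟩ (pureTensor (n + 1) fun i : Fin (n + 1) => a i)

theorem node_congr {n : ℕ} {σ σ' : Equiv.Perm (Fin n)} {a a' : ℕ → A}
    (hσ : ∀ i, (σ i : ℕ) = σ' i) (ha : ∀ i ≤ n, a i = a' i) : node n σ a = node n σ' a' := by
  have : σ = σ' := Equiv.ext fun i => Fin.ext (hσ i)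
  subst this
  exact congrArg (single (A := A) ⟨n, σ⟩) (pureTensor_congr fun i hi => ha i (by omega))

theorem single_lower_op_pureTensor (τ : LTree) (p : Fin (τ.1 + 1)) (y a : ℕ → A)
    (w : Fin (τ.1 - p) → A) (hw : ∀ i, w i = y (p + highWord τ.2 p i)) :
    single (τ.lower p)
      ((τ.upper p).op (pureTensor (τ.1 - p) w) (pureTensor (τ.1 + 1) fun i => a i)) =
      node p (lowWord τ.2 p) (contr τ.2 p y a) :=
  congrArg (single (τ.lower p)) (op_upper_pureTensor τ p y a w hw)

theorem lower_lower (τ : LTree) (q : Fin (τ.1 + 1)) (p : Fin ((q : ℕ) + 1)) :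
    (τ.lower q).lower p = τ.lower ⟨p, by omega⟩ := by
  refine Sigma.ext rfl (heq_of_eq (Equiv.ext fun k => Fin.ext ?_))
  exact congrArg (fun l => (τ.2 l : ℕ)) (lowEmb_comp τ.2 q p ⟨p, by omega⟩ rfl k k.2)

/-- Contracting in two steps along two nested cuts is contracting along the lower cut. -/
theorem single_op_op (τ : LTree) (q : Fin (τ.1 + 1)) (p : Fin ((q : ℕ) + 1)) (y : ℕ → A)
    (w : Fin (τ.1 - p) → A) (hw : ∀ i, w i = y (p + highWord τ.2 ⟨p, by omega⟩ i))
    (w₁ : Fin (q - p) → A) (hw₁ : ∀ i, w₁ i = y (p + highWord (lowWord τ.2 q) p i))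
    (w₂ : Fin (τ.1 - q) → A) (hw₂ : ∀ i, w₂ i = y (q + highWord τ.2 q i)) (a : TPow A (τ.1 + 1)) :
    single (τ.lower ⟨p, by omega⟩) ((τ.upper ⟨p, by omega⟩).op (pureTensor (τ.1 - p) w) a) =
      single ((τ.lower q).lower p) (((τ.lower q).upper p).op (pureTensor (q - p) w₁)
        ((τ.upper q).op (pureTensor (τ.1 - q) w₂) a)) := by
  have := lta_ext_pureTensor
    (f := single (τ.lower ⟨p, by omega⟩) ∘ₗ
      ((τ.upper ⟨p, by omega⟩).op (pureTensor (τ.1 - p) w)).toLinearMap)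
    (g := single ((τ.lower q).lower p) ∘ₗ (((τ.lower q).upper p).op (pureTensor (q - p) w₁) ∘L
        ((τ.upper q).op (pureTensor (τ.1 - q) w₂))).toLinearMap)
    (fun τ' => continuous_single_apply _ τ' (ContinuousLinearMap.continuous _))
    (fun τ' => continuous_single_apply _ τ' (ContinuousLinearMap.continuous _)) ?_
  · exact LinearMap.congr_fun this a
  · intro a
    refine (single_lower_op_pureTensor τ ⟨p, by omega⟩ y a w hw).trans ?_
    have h1 := op_upper_pureTensor τ q y a w₂ hw₂
    have h2 := single_lower_op_pureTensor (τ.lower q) p y (contr τ.2 q y a) w₁ hw₁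
    refine Eq.trans ?_ ((h2.symm).trans ?_)
    · refine node_congr (fun k => ?_) fun i hi => ?_
      · exact (congrArg (fun l => (τ.2 l : ℕ)) (lowEmb_comp τ.2 q p ⟨p, by omega⟩ rfl k k.2)).symm
      · exact (contr_comp τ.2 q p ⟨p, by omega⟩ rfl y a i hi).symm
    · exact congrArg (fun b => single ((τ.lower q).lower p)
        (((τ.lower q).upper p).op (pureTensor (q - p) w₁) b)) h1.symm

/-- The operator contracting the top generation of a tree with the element `x`. -/
def topContr (x : A) : Module.End ℂ (LTA A) :=
  DirectSum.toModule ℂ LTree (LTA A) fun τ =>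
    if τ.1 = 0 then 0 else
      single (τ.lower ⟨τ.1 - 1, by omega⟩) ∘ₗ
        ((τ.upper ⟨τ.1 - 1, by omega⟩).op (pureTensor _ fun _ => x)).toLinearMap

theorem topContr_single (x : A) (τ : LTree) (h : τ.1 ≠ 0) (a : TPow A (τ.1 + 1)) :
    topContr x (single τ a) = single (τ.lower ⟨τ.1 - 1, by omega⟩)
      ((τ.upper ⟨τ.1 - 1, by omega⟩).op (pureTensor _ fun _ => x) a) := by
  rw [topContr, single, DirectSum.toModule_lof, if_neg h]
  rfl

theorem topContr_single_of_eq_zero (x : A) (τ : LTree) (h : τ.1 = 0) (a : TPow A (τ.1 + 1)) :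
    topContr x (single τ a) = 0 := by
  rw [topContr, single, DirectSum.toModule_lof, if_pos h]
  rfl

theorem continuous_topContr_single_apply {T : Type*} [TopologicalSpace T] (x : A) (τ τ' : LTree)
    {f : T → TPow A (τ.1 + 1)} (hf : Continuous f) :
    Continuous fun t => topContr x (single τ (f t)) τ' := by
  by_cases h : τ.1 = 0
  · simp only [topContr_single_of_eq_zero x τ h]
    exact continuous_const
  · simp only [topContr_single x τ h]
    exact continuous_single_apply _ _ ((ContinuousLinearMap.continuous _).comp hf)

theorem lowEmb_eq_succAbove {N : ℕ} (π : Equiv.Perm (Fin (N + 1))) (pos : Fin (N + 1))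
    (hpos : π pos = Fin.last N) (k : Fin N) :
    lowEmb π ⟨N, by omega⟩ k = pos.succAbove k := by
  have := (lowPos π ⟨N, by omega⟩).orderEmbOfFin_unique (card_lowPos π ⟨N, by omega⟩)
    (f := fun k : Fin N => pos.succAbove k)
    (fun k => by
      rw [mem_lowPos]
      refine lt_of_le_of_ne (Nat.lt_succ_iff.1 (Fin.is_lt _)) fun h => ?_
      have : π (pos.succAbove k) = π pos := hpos ▸ Fin.ext h
      exact Fin.succAbove_ne _ _ (π.injective this))
    (Fin.strictMono_succAbove pos)
  exact (congrFun this k).symm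

/-- Only the vertex at `pos` lies above this cut. The trees up to that vertex start at their own
index; the later ones are shifted by the one extra leaf of the tree containing it. -/
theorem cut_top {N : ℕ} (π : Equiv.Perm (Fin (N + 1))) (pos : Fin (N + 1))
    (hpos : π pos = Fin.last N) (j : ℕ) (hj : j ≤ N + 1) :
    cut π ⟨N, by omega⟩ j = if j ≤ pos then j else j + 1 := by
  rcases j with _ | j
  · simp [cut]
  · by_cases hjN : j < N
    · rw [cut_succ_of_lt π ⟨N, by omega⟩ hjN, lowEmb_eq_succAbove π pos hpos]
      simp only [Fin.succAbove, Fin.lt_def, Fin.val_castSucc]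
      split_ifs <;> simp <;> omega
    · have : j = N := by omega
      subst this
      rw [cut_succ_of_le π ⟨j, by omega⟩ le_rfl, if_neg (by omega)]
      simp

/-- The leaves remaining after the contraction of the vertex at position `pos` with `x`. -/
def contractAt (pos : ℕ) (x : A) (a : ℕ → A) (j : ℕ) : A :=
  if j < pos then a j else if j = pos then a pos * x * a (pos + 1) else a (j + 1)

theorem topContr_node {N : ℕ} (π : Equiv.Perm (Fin (N + 1))) (pos : Fin (N + 1))
    (hpos : π pos = Fin.last N) (x : A) (a : ℕ → A) :
    topContr x (node (N + 1) π a) = node N (lowWord π ⟨N, by omega⟩) (contractAt pos x a) := by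
  rw [node, topContr_single x ⟨N + 1, π⟩ (Nat.succ_ne_zero N)]
  refine (single_lower_op_pureTensor ⟨N + 1, π⟩
    ⟨N, Nat.lt_succ_of_lt (Nat.lt_succ_self N)⟩ (fun _ => x) a (fun _ => x)
    fun _ => rfl).trans (node_congr (fun _ => rfl) fun j hj => ?_)
  change j ≤ N at hj
  have hp := pos.2
  have h1 := cut_top π pos hpos j (by omega)
  have h2 := cut_top π pos hpos (j + 1) (by omega)
  simp only [contr, contractAt]
  rw [h1, h2]
  rcases lt_trichotomy j (pos : ℕ) with h | h | h
  · rw [if_pos (by omega), if_pos (by omega), if_pos h, show j + 1 - j - 1 = 0 by omega]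
    rfl
  · subst h
    rw [if_pos le_rfl, if_neg (by omega), if_neg (lt_irrefl _), if_pos rfl,
      show (pos : ℕ) + 1 + 1 - pos - 1 = 1 by omega]
    simp only [seg, letters, add_zero, dif_pos hp]
  · rw [if_neg (by omega), if_neg (by omega), if_neg (by omega), if_neg (by omega),
      show j + 1 + 1 - (j + 1) - 1 = 0 by omega]
    rfl

theorem lowWord_top_apply {N : ℕ} (π : Equiv.Perm (Fin (N + 1))) (pos : Fin (N + 1))
    (hpos : π pos = Fin.last N) (k : Fin N) :
    (lowWord π ⟨N, by omega⟩ k : ℕ) = π (pos.succAbove k) :=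
  congrArg (fun l => (π l : ℕ)) (lowEmb_eq_succAbove π pos hpos k)

end Node

/-! ### Shuffles and the position of their largest letter -/

section Shuffle

variable {A : Type*} [CStarAlgebra A]

theorem shuffle_single (α β : LTree) (a : TPow A (α.1 + 1)) (b : TPow A (β.1 + 1)) :
    shuffle (single α a) (single β b) = ∑ s ∈ shuffles α.1 β.1,
      single ⟨α.1 + β.1, s * shiftedConcat α.2 β.2⟩ (merge α.1 β.1 a b) := by
  have h1 : shuffle (single α a) = _ :=
    DirectSum.toModule_lof (R := ℂ) (M := fun τ : LTree => TPow A (τ.1 + 1)) α a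
  rw [h1, LinearMap.flip_apply]
  have h2 := DirectSum.toModule_lof (R := ℂ) (M := fun τ : LTree => TPow A (τ.1 + 1))
    (φ := fun β : LTree => LinearMap.flip <| ∑ s ∈ shuffles α.1 β.1,
        LinearMap.mk₂ ℂ
          (fun a b => single (A := A) ⟨α.1 + β.1, s * shiftedConcat α.2 β.2⟩ (merge α.1 β.1 a b))
          (fun _ _ _ => by simp) (fun _ _ _ => by simp)
          (fun _ _ _ => by simp) (fun _ _ _ => by simp)) β b
  refine (LinearMap.congr_fun h2 a).trans ?_
  rw [LinearMap.flip_apply]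
  simp only [LinearMap.sum_apply, LinearMap.mk₂_apply]

/-- The sequence of the factors of the product `(a 0 ⊗ ⋯ ⊗ a n) · (b 0 ⊗ b 1 ⊗ ⋯)`. -/
def mergeSeq (n : ℕ) (a b : ℕ → A) (j : ℕ) : A :=
  if j < n then a j else if j = n then a n * b 0 else b (j - n)

theorem merge_pureTensor (n m : ℕ) (a b : ℕ → A) :
    merge n m (pureTensor (n + 1) fun i => a i) (pureTensor (m + 1) fun i => b i) =
      pureTensor (n + m + 1) fun i => mergeSeq n a b i := by
  rw [merge, lift₂_pureTensor]
  refine congrArg (pureTensor (n + m + 1)) (funext fun j => ?_)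
  simp only [mergeBlock, mergeSeq]
  rcases lt_trichotomy (j : ℕ) n with h | h | h
  · rw [dif_pos (by omega), if_neg (by omega), if_pos h]
    simp
  · rw [dif_pos (by omega), if_pos (by omega), if_neg (by omega), if_pos h]
    simp [h]
  · rw [dif_neg (by omega), if_pos (by omega), if_neg (by omega), if_neg (by omega)]
    simp

/-- The shifted concatenation of two words, on the letters `0, …, N - 1` with `N = n + m`. -/
def conc {n m N : ℕ} (h : n + m = N) (α : Equiv.Perm (Fin n)) (β : Equiv.Perm (Fin m)) :
    Equiv.Perm (Fin N) :=
  (finCongr h).permCongr (shiftedConcat α β)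

theorem conc_apply_of_lt {n m N : ℕ} (h : n + m = N) (α : Equiv.Perm (Fin n))
    (β : Equiv.Perm (Fin m)) (i : Fin N) (hi : (i : ℕ) < n) :
    (conc h α β i : ℕ) = α ⟨i, hi⟩ := by
  subst h
  have key : ∀ k : Fin n, (conc rfl α β (Fin.castAdd m k) : ℕ) = α k := fun k => by
    simp [conc, shiftedConcat, Equiv.permCongr_apply]
  exact key ⟨i, hi⟩

theorem conc_apply_of_le {n m N : ℕ} (h : n + m = N) (α : Equiv.Perm (Fin n))
    (β : Equiv.Perm (Fin m)) (i : Fin N) (hi : n ≤ (i : ℕ)) :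
    (conc h α β i : ℕ) = n + β ⟨i - n, by omega⟩ := by
  subst h
  have : i = Fin.natAdd n ⟨i - n, by omega⟩ := Fin.ext (by simp; omega)
  have key : ∀ k : Fin m, (conc rfl α β (Fin.natAdd n k) : ℕ) = n + β k := fun k => by
    simp [conc, shiftedConcat, Equiv.permCongr_apply]
  exact (congrArg (fun l => (conc rfl α β l : ℕ)) this).trans (key _)

/-- `s` is increasing on the positions smaller than `n` and on the other ones. -/
def IsShuffle {N : ℕ} (n : ℕ) (s : Equiv.Perm (Fin N)) : Prop :=
  ∀ i j : Fin N, i < j → ((j : ℕ) < n ∨ n ≤ (i : ℕ)) → s i < s j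

-- Leaving `N` free with an equation `n + m = N` allows lengths such as `k + 1 + m` to be read as `N
-- + 1`, so that the top letter can be removed without transport.
open Classical in
theorem shuffle_node {n m N : ℕ} (h : n + m = N) (α : Equiv.Perm (Fin n))
    (β : Equiv.Perm (Fin m)) (a b : ℕ → A) :
    shuffle (node n α a) (node m β b) =
      ∑ s : Equiv.Perm (Fin N) with IsShuffle n s, node N (s * conc h α β) (mergeSeq n a b) := by
  subst h
  rw [node, node, shuffle_single, merge_pureTensor]
  refine Finset.sum_congr ?_ fun s _ => rfl
  ext s
  simp only [shuffles, Finset.mem_filter, Finset.mem_univ, true_and]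
  constructor
  · rintro ⟨h1, h2⟩ i j hij (hj | hi)
    · exact h1 (a := ⟨i, lt_trans hij hj⟩) (b := ⟨j, hj⟩) hij
    · have e : ∀ k : Fin (n + m), n ≤ (k : ℕ) → ∃ l : Fin m, k = Fin.natAdd n l := fun k hk =>
        ⟨⟨k - n, by omega⟩, Fin.ext (by simp; omega)⟩
      obtain ⟨i, rfl⟩ := e i hi
      obtain ⟨j, rfl⟩ := e j (hi.trans hij.le)
      exact h2 ((Fin.natAdd_lt_natAdd_iff n).1 hij)
  · intro hs
    constructor
    · intro i j hij
      exact hs _ _ hij (Or.inl j.2)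
    · intro i j hij
      exact hs _ _ ((Fin.natAdd_lt_natAdd_iff n).2 hij) (Or.inr (by simp))

/-- The word `s` with a new largest letter inserted at the position `pos`. -/
def insertTop {N : ℕ} (pos : Fin (N + 1)) (s : Equiv.Perm (Fin N)) : Equiv.Perm (Fin (N + 1)) :=
  ((finSuccEquiv' pos).trans (Equiv.optionCongr s)).trans (finSuccEquiv' (Fin.last N)).symm

theorem insertTop_self {N : ℕ} (pos : Fin (N + 1)) (s : Equiv.Perm (Fin N)) :
    insertTop pos s pos = Fin.last N := by
  simp [insertTop]

theorem insertTop_succAbove {N : ℕ} (pos : Fin (N + 1)) (s : Equiv.Perm (Fin N)) (k : Fin N) :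
    insertTop pos s (pos.succAbove k) = (s k).castSucc := by
  simp [insertTop]

theorem insertTop_injective {N : ℕ} (pos : Fin (N + 1)) : Function.Injective (insertTop pos) := by
  intro s s' h
  refine Equiv.ext fun k => Fin.castSucc_injective _ ?_
  rw [← insertTop_succAbove, ← insertTop_succAbove, h]

theorem insertTop_lowWord {N : ℕ} (π : Equiv.Perm (Fin (N + 1))) (pos : Fin (N + 1))
    (hpos : π pos = Fin.last N) :
    insertTop pos (lowWord π ⟨N, by omega⟩ : Equiv.Perm (Fin N)) = π := by
  refine Equiv.ext fun i => ?_
  rcases eq_or_ne i pos with rfl | h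
  · rw [insertTop_self, hpos]
  · obtain ⟨k, rfl⟩ := Fin.exists_succAbove_eq h
    rw [insertTop_succAbove]
    exact Fin.ext (lowWord_top_apply π pos hpos k)

theorem topContr_node_eq {N : ℕ} (π : Equiv.Perm (Fin (N + 1))) (π' : Equiv.Perm (Fin N))
    (pos : Fin (N + 1)) (hpos : π pos = Fin.last N)
    (hπ : ∀ k, (π' k : ℕ) = π (pos.succAbove k)) (x : A) (a : ℕ → A) :
    topContr x (node (N + 1) π a) = node N π' (contractAt pos x a) := by
  rw [topContr_node π pos hpos]
  exact node_congr (fun k => (lowWord_top_apply π pos hpos k).trans (hπ k).symm) fun _ _ => rfl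

/-- The hypothesis says that `pos` is the end of one of the two increasing runs; a largest value can
be added or removed there without affecting monotonicity. -/
theorem isShuffle_insertTop_iff {N n n' : ℕ} (pos : Fin (N + 1)) (s : Equiv.Perm (Fin N))
    (h : (n = n' + 1 ∧ (pos : ℕ) = n') ∨ (n = n' ∧ (pos : ℕ) = N)) :
    IsShuffle n (insertTop pos s) ↔ IsShuffle n' s := by
  have hlt : ∀ i j : Fin N, pos.succAbove i < pos.succAbove j ↔ i < j := fun i j =>
    (Fin.strictMono_succAbove pos).lt_iff_lt
  have hcond : ∀ i : Fin N, ((pos.succAbove i : Fin (N + 1)) : ℕ) < n ↔ (i : ℕ) < n' := by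
    intro i
    simp only [Fin.succAbove, Fin.lt_def, Fin.val_castSucc]
    split_ifs <;> simp only [Fin.val_castSucc, Fin.val_succ] <;> omega
  constructor
  · intro hs i j hij hc
    have := hs (pos.succAbove i) (pos.succAbove j) ((hlt i j).2 hij)
      (hc.imp (hcond j).2 fun h' => not_lt.1 fun h'' => absurd ((hcond i).1 h'') (not_lt.2 h'))
    rw [insertTop_succAbove, insertTop_succAbove] at this
    exact this
  · intro hs i j hij hc
    rcases eq_or_ne i pos with rfl | hi
    · exfalso
      rw [Fin.lt_def] at hij
      omega
    · obtain ⟨i, rfl⟩ := Fin.exists_succAbove_eq hi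
      rcases eq_or_ne j pos with rfl | hj
      · rw [insertTop_self, insertTop_succAbove]
        exact Fin.castSucc_lt_last _
      · obtain ⟨j, rfl⟩ := Fin.exists_succAbove_eq hj
        rw [insertTop_succAbove, insertTop_succAbove]
        exact hs i j ((hlt i j).1 hij) (hc.imp (hcond j).1
          fun h' => not_lt.1 fun h'' => absurd ((hcond i).2 h'') (not_lt.2 h'))

open Classical in
/-- Summing over the shuffles with the top letter at a given extremal position. -/
theorem sum_shuffles_top {N n n' : ℕ} (pos : Fin (N + 1))
    (h : (n = n' + 1 ∧ (pos : ℕ) = n') ∨ (n = n' ∧ (pos : ℕ) = N))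
    {V : Type*} [AddCommMonoid V] (F : Equiv.Perm (Fin (N + 1)) → V) :
    ∑ s : Equiv.Perm (Fin (N + 1)) with IsShuffle n s ∧ s pos = Fin.last N, F s =
      ∑ s : Equiv.Perm (Fin N) with IsShuffle n' s, F (insertTop pos s) := by
  symm
  refine Finset.sum_bij (fun s _ => insertTop pos s) (fun s hs => ?_)
    (fun s _ s' _ hss => insertTop_injective pos hss) (fun π hπ => ?_) fun _ _ => rfl
  · simp only [Finset.mem_filter, Finset.mem_univ, true_and] at hs ⊢
    exact ⟨(isShuffle_insertTop_iff pos s h).2 hs, insertTop_self pos s⟩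
  · simp only [Finset.mem_filter, Finset.mem_univ, true_and] at hπ
    have := insertTop_lowWord π pos hπ.2
    refine ⟨lowWord π ⟨N, by omega⟩, ?_, this⟩
    simp only [Finset.mem_filter, Finset.mem_univ, true_and]
    rw [← isShuffle_insertTop_iff pos _ h, this]
    exact hπ.1

/-- Otherwise the next position would belong to the same run and would have to carry a larger value.
-/
theorem IsShuffle.top_left_or_right {N n : ℕ} {s : Equiv.Perm (Fin (N + 1))} (hs : IsShuffle n s)
    (hn : n ≤ N + 1) (i : Fin (N + 1)) (hi : s i = Fin.last N) :
    (i : ℕ) + 1 = n ∨ (n ≤ N ∧ (i : ℕ) = N) := by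
  by_contra hcon
  have hlt : (i : ℕ) + 1 < N + 1 := by omega
  have := hs i ⟨i + 1, hlt⟩ (Fin.lt_def.2 (Nat.lt_succ_self _)) (by simp only; omega)
  rw [hi] at this
  exact absurd this (not_lt.2 (Fin.le_last _))

theorem val_succAbove {N : ℕ} (pos : Fin (N + 1)) (i : Fin N) :
    (pos.succAbove i : ℕ) = if (i : ℕ) < pos then (i : ℕ) else i + 1 := by
  simp only [Fin.succAbove, Fin.lt_def, Fin.val_castSucc]
  split_ifs <;> rfl

-- When `s` sends the last letter of the left run to the top, the top vertex of the product is the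
-- top vertex of `α`. Contracting it leaves a shuffle of the contracted `α` with `β`, and each such
-- shuffle arises once.
open Classical in
theorem sum_topContr_left {k m N : ℕ} (h : k + 1 + m = N + 1) (α : Equiv.Perm (Fin (k + 1)))
    (β : Equiv.Perm (Fin m)) (x : A) (a b : ℕ → A) :
    ∑ s : Equiv.Perm (Fin (N + 1)) with IsShuffle (k + 1) s ∧ s ⟨k, by omega⟩ = Fin.last N,
      topContr x (node (N + 1) (s * conc h α β) (mergeSeq (k + 1) a b)) =
    shuffle (topContr x (node (k + 1) α a)) (node m β b) := by
  obtain ⟨q, hq⟩ := α.surjective (Fin.last k)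
  have h' : k + m = N := by omega
  rw [topContr_node α q hq, sum_shuffles_top (n' := k) ⟨k, by omega⟩ (Or.inl ⟨rfl, rfl⟩)]
  refine Eq.trans ?_ (shuffle_node h' (lowWord α ⟨k, by omega⟩) β (contractAt q x a) b).symm
  refine Finset.sum_congr rfl fun s _ => ?_
  have hq' := q.2
  rw [topContr_node_eq _ (s * conc h' (lowWord α ⟨k, by omega⟩) β) ⟨q, by omega⟩ ?_ fun i => ?_]
  · refine node_congr (fun _ => rfl) fun j _ => ?_
    simp only [contractAt, mergeSeq]
    rcases lt_trichotomy j (q : ℕ) with hj | hj | hj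
    · rw [if_pos hj, if_pos (by omega), if_pos (by omega), if_pos hj]
    · subst hj
      rcases lt_or_eq_of_le (Nat.lt_succ_iff.1 hq') with hk | hk
      · simp [hk, Nat.lt_succ_of_lt hk]
      -- Here the contracted vertex touches the merged leaf, and the two orders of multiplication
      -- agree by associativity.
      · simp [hk, mul_assoc]
    · rw [if_neg (by omega), if_neg (by omega)]
      rcases lt_trichotomy j k with hk | hk | hk
      · rw [if_pos (by omega), if_pos hk, if_neg (by omega), if_neg (by omega)]
      · subst hk
        rw [if_neg (by omega), if_pos rfl, if_neg (by omega), if_pos rfl, if_neg (by omega),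
          if_neg (by omega)]
      · rw [if_neg (by omega), if_neg (by omega), if_neg (by omega), if_neg (by omega)]
        congr 1
        omega
  · rw [Equiv.Perm.mul_apply]
    have : conc h α β ⟨q, by omega⟩ = ⟨k, by omega⟩ := by
      apply Fin.ext
      rw [conc_apply_of_lt h α β _ hq']
      exact congrArg Fin.val hq
    rw [this, insertTop_self]
  · rw [Equiv.Perm.mul_apply, Equiv.Perm.mul_apply]
    have : conc h α β (Fin.succAbove ⟨q, by omega⟩ i) =
        Fin.succAbove ⟨k, by omega⟩ (conc h' (lowWord α ⟨k, by omega⟩) β i) := by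
      apply Fin.ext
      rw [val_succAbove ⟨k, by omega⟩]
      have h2 := val_succAbove (⟨q, by omega⟩ : Fin (N + 1)) i
      simp only at h2 ⊢
      rcases lt_or_ge (i : ℕ) k with hi | hi
      · have h3 := conc_apply_of_lt h' (lowWord α ⟨k, by omega⟩) β i hi
        have h4 := lowWord_top_apply α q hq ⟨i, hi⟩
        have h5 := (lowWord α ⟨k, by omega⟩ ⟨i, hi⟩).2
        have h6 := val_succAbove q ⟨i, hi⟩
        rw [if_pos (h3.trans_lt h5), h3]
        rw [conc_apply_of_lt h α β _ (by rw [h2]; split_ifs <;> omega)]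
        refine Eq.trans ?_ h4.symm
        refine congrArg (fun l => (α l : ℕ)) (Fin.ext ?_)
        exact h2.trans h6.symm
      · have h3 := conc_apply_of_le h' (lowWord α ⟨k, by omega⟩) β i hi
        rw [if_neg (by omega)] at h2
        rw [if_neg (by omega), h3, conc_apply_of_le h α β _ (by omega)]
        have : ∀ (c d : ℕ) (hc : c < m) (hd : d < m), c = d → (β ⟨c, hc⟩ : ℕ) = β ⟨d, hd⟩ := by
          rintro c d hc hd rfl
          rfl
        rw [this _ (i - k) _ (by omega) (by rw [h2]; omega)]
        omega
    rw [this, insertTop_succAbove]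
    rfl

-- The mirror case: the top vertex of the product comes from `β`, and its position is shifted by
-- `n`.
open Classical in
theorem sum_topContr_right {n l N : ℕ} (h : n + (l + 1) = N + 1) (α : Equiv.Perm (Fin n))
    (β : Equiv.Perm (Fin (l + 1))) (x : A) (a b : ℕ → A) :
    ∑ s : Equiv.Perm (Fin (N + 1)) with IsShuffle n s ∧ s (Fin.last N) = Fin.last N,
      topContr x (node (N + 1) (s * conc h α β) (mergeSeq n a b)) =
    shuffle (node n α a) (topContr x (node (l + 1) β b)) := by
  obtain ⟨q, hq⟩ := β.surjective (Fin.last l)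
  have h' : n + l = N := by omega
  rw [topContr_node β q hq, sum_shuffles_top _ (Or.inr ⟨rfl, rfl⟩)]
  refine Eq.trans ?_ (shuffle_node h' α (lowWord β ⟨l, by omega⟩) a (contractAt q x b)).symm
  refine Finset.sum_congr rfl fun s _ => ?_
  have hq' := q.2
  have hβ : ∀ (c : ℕ) (r : Fin (l + 1)) (hc : c < l + 1), c = r → (β ⟨c, hc⟩ : ℕ) = β r := by
    rintro c r hc rfl
    rfl
  rw [topContr_node_eq _ (s * conc h' α (lowWord β ⟨l, by omega⟩)) ⟨n + q, by omega⟩ ?_ fun i => ?_]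
  · refine node_congr (fun _ => rfl) fun j _ => ?_
    simp only [contractAt, mergeSeq]
    rcases lt_trichotomy j (n + q : ℕ) with hj | hj | hj
    · rw [if_pos hj]
      rcases lt_trichotomy j n with hn | hn | hn
      · rw [if_pos hn, if_pos hn]
      · rw [if_neg (by omega), if_pos hn, if_neg (by omega), if_pos hn, if_pos (by omega)]
      · rw [if_neg (by omega), if_neg (by omega), if_neg (by omega), if_neg (by omega),
          if_pos (by omega)]
    · subst hj
      rw [if_neg (by omega), if_pos rfl, if_neg (by omega), if_neg (by omega : ¬ n + q + 1 < n),
        if_neg (by omega : ¬ n + (q : ℕ) + 1 = n), show n + (q : ℕ) + 1 - n = q + 1 by omega]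
      by_cases h0 : (q : ℕ) = 0
      -- The contracted vertex of `β` is its first one and touches the merged leaf; associativity is
      -- needed again.
      · simp [h0, mul_assoc]
      · rw [if_neg (by omega), if_neg (by omega), if_neg (by omega), Nat.add_sub_cancel_left,
          if_neg (lt_irrefl _), if_pos rfl]
    · rw [if_neg (by omega), if_neg (by omega), if_neg (by omega), if_neg (by omega),
        if_neg (by omega), if_neg (by omega), if_neg (by omega), if_neg (by omega)]
      congr 1
      omega
  · rw [Equiv.Perm.mul_apply]
    have : conc h α β ⟨n + q, by omega⟩ = Fin.last N := by
      apply Fin.ext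
      rw [conc_apply_of_le h α β _ (by simp only; omega), hβ _ q _ (by simp), hq, Fin.val_last,
        Fin.val_last]
      omega
    rw [this, insertTop_self]
  · rw [Equiv.Perm.mul_apply, Equiv.Perm.mul_apply]
    have : conc h α β (Fin.succAbove ⟨n + q, by omega⟩ i) =
        (conc h' α (lowWord β ⟨l, by omega⟩) i).castSucc := by
      apply Fin.ext
      have h2 := val_succAbove (⟨n + q, by omega⟩ : Fin (N + 1)) i
      simp only at h2
      rw [Fin.val_castSucc]
      rcases lt_or_ge (i : ℕ) n with hi | hi
      · rw [if_pos (by omega)] at h2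
        rw [conc_apply_of_lt h' α _ i hi, conc_apply_of_lt h α β _ (by omega)]
        exact congrArg (fun l => (α l : ℕ)) (Fin.ext h2)
      · have h4 := lowWord_top_apply β q hq ⟨i - n, by omega⟩
        have h6 := val_succAbove q ⟨i - n, by omega⟩
        simp only at h6
        have h7 : n ≤ (Fin.succAbove (⟨n + q, by omega⟩ : Fin (N + 1)) i : ℕ) := by
          rw [h2]; split_ifs <;> omega
        rw [conc_apply_of_le h' α _ i hi, conc_apply_of_le h α β _ h7]
        refine congrArg (n + ·) ((hβ _ _ _ ?_).trans h4.symm)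
        rw [h2, h6]
        split_ifs <;> omega
    rw [this, ← Fin.succAbove_last, insertTop_succAbove]
    rfl

open Classical in
/-- Contracting the top generation is a derivation of the shuffle product. -/
theorem topContr_shuffle_node {n m : ℕ} (α : Equiv.Perm (Fin n)) (β : Equiv.Perm (Fin m)) (x : A)
    (a b : ℕ → A) : topContr x (shuffle (node n α a) (node m β b)) =
      shuffle (topContr x (node n α a)) (node m β b) +
        shuffle (node n α a) (topContr x (node m β b)) := by
  have h0 : ∀ (σ : Equiv.Perm (Fin 0)) (c : ℕ → A), topContr x (node 0 σ c) = 0 := fun σ c =>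
    topContr_single_of_eq_zero x ⟨0, σ⟩ rfl _
  rcases hN : n + m with _ | N
  · obtain rfl : n = 0 := by omega
    obtain rfl : m = 0 := by omega
    rw [shuffle_node hN, map_sum, h0, h0]
    simp [h0]
  -- The shuffles are split according to the run containing the preimage of the top letter; each
  -- half gives one term of the Leibniz rule.
  · rw [shuffle_node hN, map_sum, ← Finset.sum_filter_add_sum_filter_not _
      fun s : Equiv.Perm (Fin (N + 1)) => ((s.symm (Fin.last N) : Fin (N + 1)) : ℕ) < n]
    congr 1
    · rcases n with _ | k
      · rw [h0]
        simp
      · rw [← sum_topContr_left hN, Finset.filter_filter]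
        refine Finset.sum_congr (Finset.filter_congr fun s _ => and_congr_right fun hs => ?_)
          fun _ _ => rfl
        have h1 := hs.top_left_or_right (by omega) (s.symm (Fin.last N)) (by simp)
        rw [← Equiv.eq_symm_apply, Fin.ext_iff]
        simp only
        omega
    · rcases m with _ | l
      -- For `m = 0` the right run is empty, so no shuffle has its top letter there.
      · rw [h0, map_zero]
        refine Finset.sum_eq_zero fun s hs => ?_
        rw [Finset.mem_filter] at hs
        exact absurd (lt_of_lt_of_eq (Fin.is_lt _) (by omega)) hs.2
      · rw [← sum_topContr_right hN, Finset.filter_filter]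
        refine Finset.sum_congr (Finset.filter_congr fun s _ => and_congr_right fun hs => ?_)
          fun _ _ => rfl
        have h1 := hs.top_left_or_right (by omega) (s.symm (Fin.last N)) (by simp)
        rw [← Equiv.eq_symm_apply, Fin.ext_iff, Fin.val_last]
        omega

end Shuffle

/-! ### Iterated integrals of continuous functions -/

section IterInt

variable {E : Type*} [NormedAddCommGroup E]

theorem continuous_finCons {k : ℕ} : Continuous fun p : ℝ × (Fin k → ℝ) =>
    (Fin.cons p.1 p.2 : Fin (k + 1) → ℝ) :=
  continuous_pi fun i => by
    refine Fin.cases ?_ (fun i => ?_) i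
    · simpa using continuous_fst
    · exact (continuous_apply i).comp continuous_snd

theorem continuous_cons_right {k : ℕ} {F : (Fin (k + 1) → ℝ) → E} (hF : Continuous F) (r : ℝ) :
    Continuous fun u : Fin k → ℝ => F (Fin.cons r u) :=
  hF.comp (continuous_finCons.comp (continuous_const.prodMk continuous_id))

variable [NormedSpace ℝ E]

/-- The parameter space is arbitrary because the induction enlarges it: the outer integration
variable becomes a parameter of the inner integral, and also its upper limit. -/
theorem continuous_iterInt {k : ℕ} {T : Type*} [TopologicalSpace T] [FirstCountableTopology T]
    {F : T → (Fin k → ℝ) → E} (hF : Continuous fun q : T × (Fin k → ℝ) => F q.1 q.2) (s : ℝ)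
    {g : T → ℝ} (hg : Continuous g) : Continuous fun p => iterInt k (F p) s (g p) := by
  induction k generalizing T with
  | zero => exact hF.comp (continuous_id.prodMk continuous_const)
  | succ k ih =>
    simp only [iterInt]
    refine intervalIntegral.continuous_parametric_intervalIntegral_of_continuous ?_ hg
    refine ih (T := T × ℝ) (F := fun p u => F p.1 (Fin.cons p.2 u)) ?_ continuous_snd
    exact hF.comp ((continuous_fst.comp continuous_fst).prodMk
      (continuous_finCons.comp ((continuous_snd.comp continuous_fst).prodMk continuous_snd)))

theorem continuous_iterInt_cons {k : ℕ} {F : (Fin (k + 1) → ℝ) → E} (hF : Continuous F) (s : ℝ) :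
    Continuous fun r : ℝ => iterInt k (fun u => F (Fin.cons r u)) s r :=
  continuous_iterInt (F := fun r u => F (Fin.cons r u)) (hF.comp continuous_finCons) s
    continuous_id

/-- The fundamental theorem of calculus for the outermost integral: the first and largest time is
frozen at `t`. The equation `K = k + 1` accommodates lengths given by subtractions. -/
theorem hasDerivAt_iterInt [CompleteSpace E] {k K : ℕ} (h : K = k + 1) {F : (Fin K → ℝ) → E}
    (hF : Continuous F) (s t : ℝ) : HasDerivAt (iterInt K F s)
      (iterInt k (fun u => F fun i => (Fin.cons t u : Fin (k + 1) → ℝ) (Fin.cast h i)) s t) t := by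
  subst h
  exact ((continuous_iterInt_cons hF s).integral_hasStrictDerivAt s t).hasDerivAt

theorem iterInt_self {k : ℕ} (hk : k ≠ 0) (F : (Fin k → ℝ) → E) (s : ℝ) : iterInt k F s s = 0 := by
  obtain ⟨k, rfl⟩ := Nat.exists_eq_succ_of_ne_zero hk
  exact intervalIntegral.integral_same

/-- All integration variables stay between `s` and `t`, in either order, hence in [0, 1]. -/
theorem iterInt_congr {k : ℕ} {F G : (Fin k → ℝ) → E} {s t : ℝ} (hs : s ∈ Set.Icc (0 : ℝ) 1)
    (ht : t ∈ Set.Icc (0 : ℝ) 1) (h : ∀ u, (∀ i, u i ∈ Set.Icc (0 : ℝ) 1) → F u = G u) :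
    iterInt k F s t = iterInt k G s t := by
  induction k generalizing t with
  | zero => exact h _ fun i => i.elim0
  | succ k ih =>
    refine intervalIntegral.integral_congr fun r hr => ih ?_ fun u hu => h _ ?_
    · exact (convex_Icc (0 : ℝ) 1).ordConnected.uIcc_subset hs ht hr
    · refine Fin.cases ?_ fun i => ?_
      · exact (convex_Icc (0 : ℝ) 1).ordConnected.uIcc_subset hs ht hr
      · exact hu i

theorem clm_iterInt {E F : Type*} [NormedAddCommGroup E] [NormedSpace ℂ E] [CompleteSpace E]
    [NormedAddCommGroup F] [NormedSpace ℂ F] [CompleteSpace F] (L : E →L[ℂ] F) {k : ℕ}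
    {f : (Fin k → ℝ) → E} (hf : Continuous f) (s t : ℝ) :
    L (iterInt k f s t) = iterInt k (fun u => L (f u)) s t := by
  induction k generalizing t with
  | zero => rfl
  | succ k ih =>
    simp only [iterInt]
    rw [← L.intervalIntegral_comp_comm ((continuous_iterInt_cons hf s).intervalIntegrable s t)]
    exact intervalIntegral.integral_congr fun r _ => ih (continuous_cons_right hf r) r

end IterInt

/-! ### The derivation property and derivatives in `LT♯(A)` -/

section Deriv

variable {A : Type*} [CStarAlgebra A]

theorem lta_sum_apply {ι : Type*} (s : Finset ι) (f : ι → LTA A) (τ : LTree) :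
    (∑ i ∈ s, f i) τ = ∑ i ∈ s, f i τ :=
  map_sum (coord τ) f s

theorem continuous_shuffle_single_apply {T : Type*} [TopologicalSpace T] (α β τ : LTree)
    {f : T → TPow A (α.1 + 1)} {g : T → TPow A (β.1 + 1)} (hf : Continuous f) (hg : Continuous g) :
    Continuous fun t => shuffle (single α (f t)) (single β (g t)) τ := by
  simp only [shuffle_single, lta_sum_apply]
  refine continuous_finsetSum _ fun s _ => continuous_single_apply _ τ ?_
  exact ((merge α.1 β.1).continuous.comp hf).clm_apply hg

theorem continuous_topContr_shuffle_single_apply {T : Type*} [TopologicalSpace T] (x : A)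
    (α β τ : LTree) {f : T → TPow A (α.1 + 1)} {g : T → TPow A (β.1 + 1)} (hf : Continuous f)
    (hg : Continuous g) :
    Continuous fun t => topContr x (shuffle (single α (f t)) (single β (g t))) τ := by
  simp only [shuffle_single, map_sum, lta_sum_apply]
  refine continuous_finsetSum _ fun s _ => continuous_topContr_single_apply x _ τ ?_
  exact ((merge α.1 β.1).continuous.comp hf).clm_apply hg

theorem continuous_shuffle_topContr_left_apply {T : Type*} [TopologicalSpace T] (x : A)
    (α β τ : LTree) {f : T → TPow A (α.1 + 1)} {g : T → TPow A (β.1 + 1)} (hf : Continuous f)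
    (hg : Continuous g) :
    Continuous fun t => shuffle (topContr x (single α (f t))) (single β (g t)) τ := by
  by_cases h : α.1 = 0
  · simp only [topContr_single_of_eq_zero x α h, map_zero, LinearMap.zero_apply]
    exact continuous_const
  · simp only [topContr_single x α h]
    exact continuous_shuffle_single_apply _ β τ ((ContinuousLinearMap.continuous _).comp hf) hg

theorem continuous_shuffle_topContr_right_apply {T : Type*} [TopologicalSpace T] (x : A)
    (α β τ : LTree) {f : T → TPow A (α.1 + 1)} {g : T → TPow A (β.1 + 1)} (hf : Continuous f)
    (hg : Continuous g) :
    Continuous fun t => shuffle (single α (f t)) (topContr x (single β (g t))) τ := by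
  by_cases h : β.1 = 0
  · simp only [topContr_single_of_eq_zero x β h, map_zero]
    exact continuous_const
  · simp only [topContr_single x β h]
    exact continuous_shuffle_single_apply α _ τ hf ((ContinuousLinearMap.continuous _).comp hg)

/-- Contracting the top generation is a derivation of the shuffle product. -/
theorem topContr_shuffle (x : A) (v w : LTA A) :
    topContr x (shuffle v w) = shuffle (topContr x v) w + shuffle v (topContr x w) := by
  induction v using lta_induction with
  | h0 => simp
  | ha v v' hv hv' =>
    simp only [map_add, LinearMap.add_apply, hv, hv']
    abel
  | hs α a =>
    induction w using lta_induction with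
    | h0 => simp
    | ha w w' hw hw' =>
      simp only [map_add, hw, hw']
      abel
    | hs β b =>
      -- Density is used one argument at a time: first `b` is pure and `a` arbitrary, then `b` is
      -- arbitrary too.
      have h1 := fun b' : ℕ → A => lta_ext_pureTensor
        (f := topContr x ∘ₗ shuffle.flip (node β.1 β.2 b') ∘ₗ single α)
        (g := shuffle.flip (node β.1 β.2 b') ∘ₗ topContr x ∘ₗ single α +
          shuffle.flip (topContr x (node β.1 β.2 b')) ∘ₗ single α)
        (fun τ => continuous_topContr_shuffle_single_apply x α β τ continuous_id continuous_const)
        (fun τ => (continuous_shuffle_topContr_left_apply x α β τ continuous_id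
          continuous_const).add (continuous_shuffle_topContr_right_apply x α β τ continuous_id
          continuous_const))
        fun a' => topContr_shuffle_node α.2 β.2 x a' b'
      have h2 := lta_ext_pureTensor
        (f := topContr x ∘ₗ shuffle (single α a) ∘ₗ single β)
        (g := shuffle (topContr x (single α a)) ∘ₗ single β +
          shuffle (single α a) ∘ₗ topContr x ∘ₗ single β)
        (fun τ => continuous_topContr_shuffle_single_apply x α β τ continuous_const continuous_id)
        (fun τ => (continuous_shuffle_topContr_left_apply x α β τ continuous_const
          continuous_id).add (continuous_shuffle_topContr_right_apply x α β τ continuous_const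
          continuous_id))
        fun b' => LinearMap.congr_fun (h1 b') a
      exact LinearMap.congr_fun h2 b

theorem eq_sum_single {S : Finset LTree} {v : LTA A} (h : ∀ τ, τ ∉ S → v τ = 0) :
    v = ∑ τ ∈ S, single τ (v τ) := by
  refine DFinsupp.ext fun τ => ?_
  rw [lta_sum_apply]
  by_cases hτ : τ ∈ S
  · rw [Finset.sum_eq_single_of_mem τ hτ fun σ _ hσ => single_apply_of_ne hσ.symm _,
      single_apply_self]
  · rw [h τ hτ, Finset.sum_eq_zero fun σ hσ => single_apply_of_ne (by rintro rfl; exact hτ hσ) _]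

theorem exists_finset_support (v : LTA A) : ∃ S : Finset LTree, ∀ τ, τ ∉ S → v τ = 0 := by
  classical
  induction v using lta_induction with
  | h0 => exact ⟨∅, fun _ _ => rfl⟩
  | hs τ a =>
    exact ⟨{τ}, fun τ' h => single_apply_of_ne (by simpa using h) a⟩
  | ha v w hv hw =>
    obtain ⟨S, hS⟩ := hv
    obtain ⟨S', hS'⟩ := hw
    refine ⟨S ∪ S', fun τ h => ?_⟩
    rw [Finset.mem_union, not_or] at h
    rw [DFinsupp.add_apply, hS τ h.1, hS' τ h.2, add_zero]

/-- `V : ℝ → LT♯(A)` takes values in the sum of finitely many components and has the derivative `V'`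
at `t`, coordinate by coordinate. -/
def HasCoordDerivAt (V : ℝ → LTA A) (V' : LTA A) (t : ℝ) : Prop :=
  (∃ S : Finset LTree, ∀ r τ, τ ∉ S → V r τ = 0) ∧ ∀ τ, HasDerivAt (fun r => V r τ) (V' τ) t

namespace HasCoordDerivAt

variable {V W : ℝ → LTA A} {V' W' : LTA A} {t : ℝ}

theorem const (v : LTA A) (t : ℝ) : HasCoordDerivAt (fun _ => v) 0 t :=
  ⟨(exists_finset_support v).imp fun _ h _ => h, fun _ => hasDerivAt_const _ _⟩

theorem add (hV : HasCoordDerivAt V V' t) (hW : HasCoordDerivAt W W' t) :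
    HasCoordDerivAt (fun r => V r + W r) (V' + W') t := by
  classical
  obtain ⟨⟨S, hS⟩, hV⟩ := hV
  obtain ⟨⟨S', hS'⟩, hW⟩ := hW
  refine ⟨⟨S ∪ S', fun r τ h => ?_⟩, fun τ => (hV τ).add (hW τ)⟩
  rw [Finset.mem_union, not_or] at h
  rw [DFinsupp.add_apply, hS r τ h.1, hS' r τ h.2, add_zero]

theorem neg (hV : HasCoordDerivAt V V' t) : HasCoordDerivAt (fun r => -V r) (-V') t := by
  obtain ⟨⟨S, hS⟩, hV⟩ := hV
  refine ⟨⟨S, fun r τ h => ?_⟩, fun τ => (hV τ).neg⟩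
  rw [DFinsupp.neg_apply, hS r τ h, neg_zero]

theorem sub (hV : HasCoordDerivAt V V' t) (hW : HasCoordDerivAt W W' t) :
    HasCoordDerivAt (fun r => V r - W r) (V' - W') t := by
  simp only [sub_eq_add_neg]
  exact hV.add hW.neg

theorem sum {ι : Type*} (s : Finset ι) {V : ι → ℝ → LTA A} {V' : ι → LTA A}
    (h : ∀ i ∈ s, HasCoordDerivAt (V i) (V' i) t) :
    HasCoordDerivAt (fun r => ∑ i ∈ s, V i r) (∑ i ∈ s, V' i) t := by
  classical
  induction s using Finset.induction_on with
  | empty => simpa using const (0 : LTA A) t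
  | insert i s hi ih =>
    simp only [Finset.sum_insert hi]
    exact (h i (Finset.mem_insert_self i s)).add
      (ih fun j hj => h j (Finset.mem_insert_of_mem hj))

theorem single (τ : LTree) {c : ℝ → TPow A (τ.1 + 1)} {c' : TPow A (τ.1 + 1)}
    (h : HasDerivAt c c' t) :
    HasCoordDerivAt (fun r => LevelledSignature.single τ (c r))
      (LevelledSignature.single τ c') t := by
  classical
  refine ⟨⟨{τ}, fun r τ' h => single_apply_of_ne (by simpa using h) _⟩, fun τ' => ?_⟩
  exact ((singleCoord τ τ').restrictScalars ℝ).hasFDerivAt.comp_hasDerivAt t h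

theorem shuffle_single (α β : LTree) {c : ℝ → TPow A (α.1 + 1)} {c' : TPow A (α.1 + 1)}
    {d : ℝ → TPow A (β.1 + 1)} {d' : TPow A (β.1 + 1)} (hc : HasDerivAt c c' t)
    (hd : HasDerivAt d d' t) :
    HasCoordDerivAt
      (fun r => shuffle (LevelledSignature.single α (c r)) (LevelledSignature.single β (d r)))
      (shuffle (LevelledSignature.single α c') (LevelledSignature.single β (d t)) +
        shuffle (LevelledSignature.single α (c t)) (LevelledSignature.single β d')) t := by
  simp only [LevelledSignature.shuffle_single, ← Finset.sum_add_distrib]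
  refine sum _ fun s _ => ?_
  rw [← map_add]
  refine single _ ?_
  refine HasDerivAt.congr_deriv (((merge α.1 β.1).bilinearRestrictScalars ℝ).hasDerivAt_of_bilinear
    (u := c) (v := d) (fun _ => hc) (fun _ => hd)) (add_comm _ _)

theorem apply_eq_zero_of_forall {τ : LTree} (hV : HasCoordDerivAt V V' t) (h : ∀ r, V r τ = 0) :
    V' τ = 0 := by
  have h1 := hV.2 τ
  simp only [h] at h1
  exact h1.unique (hasDerivAt_const t 0)

/-- The finite set of components, uniform in time, reduces the Leibniz rule to finitely many pairs
of components, on each of which the product comes from the continuous bilinear `merge`. -/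
theorem shuffle (hV : HasCoordDerivAt V V' t) (hW : HasCoordDerivAt W W' t) :
    HasCoordDerivAt (fun r => LevelledSignature.shuffle (V r) (W r))
      (LevelledSignature.shuffle V' (W t) + LevelledSignature.shuffle (V t) W') t := by
  obtain ⟨S, hS⟩ := hV.1
  obtain ⟨S', hS'⟩ := hW.1
  have e1 : ∀ r, V r = ∑ τ ∈ S, LevelledSignature.single τ (V r τ) :=
    fun r => eq_sum_single (hS r)
  have e2 : ∀ r, W r = ∑ τ ∈ S', LevelledSignature.single τ (W r τ) :=
    fun r => eq_sum_single (hS' r)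
  have e3 : V' = ∑ τ ∈ S, LevelledSignature.single τ (V' τ) :=
    eq_sum_single fun τ h => hV.apply_eq_zero_of_forall fun r => hS r τ h
  have e4 : W' = ∑ τ ∈ S', LevelledSignature.single τ (W' τ) :=
    eq_sum_single fun τ h => hW.apply_eq_zero_of_forall fun r => hS' r τ h
  have key := sum S fun α _ => sum S' fun β _ => shuffle_single α β (hV.2 α) (hW.2 β)
  convert key using 1
  · funext r
    conv_lhs => rw [e1 r, e2 r]
    simp only [map_sum, LinearMap.sum_apply]
    exact Finset.sum_comm
  · conv_lhs => rw [e1 t, e2 t, e3, e4]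
    simp only [map_sum, LinearMap.sum_apply, Finset.sum_add_distrib]
    congr 1 <;> exact Finset.sum_comm

end HasCoordDerivAt

theorem topContr_apply_eq_zero (x : A) {v : LTA A} {τ : LTree}
    (h : ∀ σ : LTree, σ.1 = τ.1 + 1 → v σ = 0) : topContr x v τ = 0 := by
  obtain ⟨S, hS⟩ := exists_finset_support v
  rw [eq_sum_single hS, map_sum, lta_sum_apply]
  refine Finset.sum_eq_zero fun σ _ => ?_
  by_cases h0 : σ.1 = 0
  · rw [topContr_single_of_eq_zero x σ h0]
    rfl
  · by_cases h1 : σ.1 = τ.1 + 1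
    · rw [h σ h1, map_zero, map_zero]
      rfl
    · rw [topContr_single x σ h0]
      refine single_apply_of_ne ?_ _
      rintro rfl
      simp only [LTree.lower] at h1
      omega

/-- The equation `V' = topContr (x t) V` has at most one solution with a given value at `s`. -/
theorem eq_zero_of_hasCoordDerivAt {x : ℝ → A} {V : ℝ → LTA A} {s : ℝ}
    (hV : ∀ t, HasCoordDerivAt V (topContr (x t) (V t)) t) (hs : V s = 0) (t : ℝ) : V t = 0 := by
  obtain ⟨S, hS⟩ := (hV s).1
  -- Descending induction on the number of generations. Trees larger than all those in `S` have zero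
  -- coordinate. Once the coordinates one generation higher vanish, the present one has zero
  -- derivative, so it keeps its value 0 from time `s`.
  have key : ∀ (k : ℕ) (τ : LTree), S.sup (fun σ => σ.1) < τ.1 + k → ∀ t, V t τ = 0 := by
    intro k
    induction k with
    | zero =>
      intro τ hτ t
      exact hS t τ fun h => absurd (Finset.le_sup (f := fun σ : LTree => σ.1) h) (not_le.2 hτ)
    | succ k ih =>
      intro τ hτ t
      have hd : ∀ r, HasDerivAt (fun r => V r τ) 0 r := fun r => by
        have := (hV r).2 τ
        rwa [topContr_apply_eq_zero (x r) fun σ hσ => ih σ (by omega) r] at this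
      have := is_const_of_deriv_eq_zero (fun r => (hd r).differentiableAt)
        (fun r => (hd r).deriv) t s
      simp only at this
      rw [this, hs]
      rfl
  refine DFinsupp.ext fun τ => ?_
  exact key (S.sup (fun σ => σ.1) + 1) τ (by omega) t

end Deriv

/-! ### The differential equation of the signature and its consequences -/

section Flow

variable {A : Type*} [CStarAlgebra A]

/-- The iterated integral of the elementary tensors with factors `x (u (σ i))`. -/
def iterVel (x : ℝ → A) {k : ℕ} (σ : Equiv.Perm (Fin k)) (s t : ℝ) : TPow A k :=
  iterInt k (fun u => pureTensor k fun i => x (u (σ i))) s t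

/-- The endomorphism `pathEndo`, in terms of the velocity `x` of the path. -/
def flow (x : ℝ → A) (s t : ℝ) : Module.End ℂ (LTA A) :=
  DirectSum.toModule ℂ LTree (LTA A) fun τ =>
    ∑ p : Fin (τ.1 + 1),
      single (τ.lower p) ∘ₗ ((τ.upper p).op (iterVel x (τ.upper p).perm s t)).toLinearMap

theorem flow_single (x : ℝ → A) (s t : ℝ) (τ : LTree) (a : TPow A (τ.1 + 1)) :
    flow x s t (single τ a) = ∑ p : Fin (τ.1 + 1),
      single (τ.lower p) ((τ.upper p).op (iterVel x (τ.upper p).perm s t) a) := by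
  have h : flow x s t (single τ a) = _ :=
    DirectSum.toModule_lof (R := ℂ) (M := fun τ : LTree => TPow A (τ.1 + 1)) τ a
  rw [h, LinearMap.sum_apply]
  rfl

/-- Only the values of the velocity on [0, 1] enter the integrals, so it may be replaced by a
function continuous on all of `ℝ`, to which the calculus above applies. -/
theorem pathEndo_eq_flow {X x : ℝ → A}
    (hx : ∀ r ∈ Set.Icc (0 : ℝ) 1, derivWithin X (Set.Icc 0 1) r = x r) {s t : ℝ}
    (hs : s ∈ Set.Icc (0 : ℝ) 1) (ht : t ∈ Set.Icc (0 : ℝ) 1) : pathEndo X s t = flow x s t := by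
  have h : ∀ {k : ℕ} (σ : Equiv.Perm (Fin k)), iterTensor X σ s t = iterVel x σ s t :=
    fun σ => iterInt_congr hs ht fun u hu => congrArg _ (funext fun i => hx _ (hu _))
  simp only [pathEndo, flow, contraction, h]

theorem continuous_vel {x : ℝ → A} (hx : Continuous x) {k l : ℕ} (e : Fin k → Fin l) :
    Continuous fun u : Fin l → ℝ => pureTensor (A := A) k fun i => x (u (e i)) :=
  (pureTensor k).cont.comp (continuous_pi fun i => hx.comp (continuous_apply (e i)))

theorem lower_last (τ : LTree) : τ.lower (Fin.last τ.1) = τ := by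
  refine Sigma.ext rfl (heq_of_eq (Equiv.ext fun k => congrArg τ.2 ?_))
  have h := ((lowPos τ.2 (Fin.last τ.1)).orderEmbOfFin_unique (card_lowPos τ.2 (Fin.last τ.1))
    (f := fun k : Fin τ.1 => k) (fun k => by simp [lowPos]) strictMono_id)
  exact (congrFun h k).symm

/-- The top cut leaves a forest without vertices, whose contraction is the identity. The equality is
stated in `LTA A` because `τ.lower (Fin.last τ.1)` equals `τ` only propositionally. -/
theorem single_op_upper_last (x : ℝ → A) (s t : ℝ) (τ : LTree) (a : TPow A (τ.1 + 1)) :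
    single (τ.lower (Fin.last τ.1)) ((τ.upper (Fin.last τ.1)).op
      (iterVel x (τ.upper (Fin.last τ.1)).perm s t) a) = single τ a := by
  obtain ⟨n, σ⟩ := τ
  have hk : ∀ (k : ℕ) (hk : k = 0) (ρ : Equiv.Perm (Fin k)),
      iterVel x ρ s t = pureTensor k fun _ => (1 : A) := by
    rintro _ rfl ρ
    exact congrArg _ (funext fun i => i.elim0)
  have h0 := hk (n - n) (Nat.sub_self n) (highWord σ (Fin.last n))
  have hl : ∀ k : Fin n, lowEmb σ (Fin.last n) k = k := fun k =>
    (congrFun ((lowPos σ (Fin.last n)).orderEmbOfFin_unique (card_lowPos σ (Fin.last n))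
      (f := fun k : Fin n => k) (fun k => by simp [lowPos]) strictMono_id) k).symm
  have hc : ∀ j, cut σ (Fin.last n) j = j := by
    rintro (_ | j)
    · rfl
    · rcases lt_or_ge j n with h | h
      · rw [cut_succ_of_lt σ (Fin.last n) h, hl]
      · rw [cut_succ_of_le σ (Fin.last n) h, Fin.val_last]
        omega
  refine LinearMap.congr_fun (lta_ext_pureTensor
    (f := single (LTree.lower ⟨n, σ⟩ (Fin.last n)) ∘ₗ ((LTree.upper ⟨n, σ⟩ (Fin.last n)).op
      (iterVel x (LTree.upper ⟨n, σ⟩ (Fin.last n)).perm s t)).toLinearMap)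
    (g := single ⟨n, σ⟩)
    (fun τ' => continuous_single_apply _ τ' (ContinuousLinearMap.continuous _))
    (fun τ' => continuous_single_apply _ τ' continuous_id) fun b => ?_) a
  refine Eq.trans (congrArg (fun c => single (LTree.lower ⟨n, σ⟩ (Fin.last n))
    ((LTree.upper ⟨n, σ⟩ (Fin.last n)).op c (pureTensor (n + 1) fun i => b i))) h0) ?_
  refine (single_lower_op_pureTensor ⟨n, σ⟩ (Fin.last n) (fun _ => 1) b (fun _ => 1)
    fun _ => rfl).trans (node_congr (fun k => ?_) fun j _ => ?_)
  · exact congrArg (fun l => (σ l : ℕ)) (hl k)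
  · simp only [contr]
    rw [hc, hc, show j + 1 - j - 1 = 0 by omega]
    rfl

/-- The top cut contributes the identity; every other cut integrates at least once over the
degenerate interval from `s` to `s`. -/
theorem flow_self (x : ℝ → A) (s : ℝ) : flow x s s = 1 := by
  refine end_ext fun τ a => ?_
  rw [flow_single, Fin.sum_univ_castSucc, single_op_upper_last, Module.End.one_apply,
    Finset.sum_eq_zero, zero_add]
  intro p _
  have : iterVel x (τ.upper p.castSucc).perm s s = 0 :=
    iterInt_self (Nat.sub_ne_zero_of_lt p.2) _ s
  rw [this, map_zero, zero_apply, map_zero]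

/-- Trees obtained by one or two successive cuts are equal without being definitionally so.
Comparing integrands inside the direct sum avoids transporting tensors along that equality. -/
theorem single_clm_iterInt {τ τ' : LTree} (hτ : τ = τ') {E E' : Type*} [NormedAddCommGroup E]
    [NormedSpace ℂ E] [CompleteSpace E] [NormedAddCommGroup E'] [NormedSpace ℂ E']
    [CompleteSpace E'] (L : E →L[ℂ] TPow A (τ.1 + 1)) (L' : E' →L[ℂ] TPow A (τ'.1 + 1)) {k : ℕ}
    {F : (Fin k → ℝ) → E} {F' : (Fin k → ℝ) → E'} (hF : Continuous F) (hF' : Continuous F')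
    (h : ∀ u, single τ (L (F u)) = single τ' (L' (F' u))) (s t : ℝ) :
    single τ (L (iterInt k F s t)) = single τ' (L' (iterInt k F' s t)) := by
  subst hτ
  rw [clm_iterInt L hF, clm_iterInt L' hF']
  congr 2
  exact funext fun u => single_injective τ (h u)

/-- The derivative of the coefficient of `flow` at a cut is the contraction of the top generation
of the next one. -/
theorem hasCoordDerivAt_flow_castSucc {x : ℝ → A} (hx : Continuous x) (s t : ℝ) (τ : LTree)
    (a : TPow A (τ.1 + 1)) (q : Fin τ.1) :
    HasCoordDerivAt (fun r => single (τ.lower q.castSucc) ((τ.upper q.castSucc).op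
        (iterVel x (τ.upper q.castSucc).perm s r) a))
      (topContr (x t) (single (τ.lower q.succ) ((τ.upper q.succ).op
        (iterVel x (τ.upper q.succ).perm s t) a))) t := by
  obtain ⟨n, σ⟩ := τ
  change Fin n at q
  have hq : n - (q : ℕ) = n - (q + 1) + 1 := by omega
  have h1 := hasDerivAt_iterInt hq (continuous_vel hx (highWord σ q.castSucc)) s t
  have h2 := (((LTree.upper ⟨n, σ⟩ q.castSucc).op.flip a).restrictScalars ℝ
    ).hasFDerivAt.comp_hasDerivAt t h1
  have h3 := HasCoordDerivAt.single (LTree.lower ⟨n, σ⟩ q.castSucc) h2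
  refine cast (congrArg (fun V' => HasCoordDerivAt _ V' t) ?_) h3
  rw [topContr_single (x t) (LTree.lower ⟨n, σ⟩ q.succ) (Nat.succ_ne_zero q)]
  refine single_clm_iterInt (lower_lower ⟨n, σ⟩ q.succ ⟨q, Nat.lt_succ_of_lt q.1.lt_succ_self⟩).symm
    ((LTree.upper ⟨n, σ⟩ q.castSucc).op.flip a)
    (((LTree.upper (LTree.lower ⟨n, σ⟩ q.succ)
      ⟨q, Nat.lt_succ_of_lt q.1.lt_succ_self⟩).op (pureTensor _ fun _ => x t)) ∘L
      ((LTree.upper ⟨n, σ⟩ q.succ).op.flip a)) ?_ (continuous_vel hx (highWord σ q.succ)) ?_ s t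
  · refine (pureTensor (n - q)).cont.comp (continuous_pi fun i => hx.comp ?_)
    exact (continuous_apply _).comp
      (continuous_finCons.comp (continuous_const.prodMk continuous_id))
  · intro u
    refine single_op_op ⟨n, σ⟩ q.succ ⟨q, Nat.lt_succ_of_lt q.1.lt_succ_self⟩
      -- Level `q` receives the frozen time `t` and level `q + 1 + i` the time `u i`; the value 1
      -- beyond the last level is never read.
      (fun l => if h : l - q < n - (q + 1) + 1 then
        x ((Fin.cons t u : Fin (n - (q + 1) + 1) → ℝ) ⟨l - q, h⟩) else 1) _ ?_ _ ?_ _ ?_ a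
    · intro i
      have h4 : (q + highWord σ q.castSucc i : ℕ) - q = highWord σ q.castSucc i :=
        Nat.add_sub_cancel_left ..
      refine Eq.trans ?_ (dif_pos (h4.trans_lt ((highWord σ q.castSucc i).2.trans_eq hq))).symm
      exact congrArg (fun l => x ((Fin.cons t u : Fin (n - (q + 1) + 1) → ℝ) l)) (Fin.ext h4.symm)
    · intro i
      have h5 : ∀ c : Fin (q + 1 - q), x t = if h : (q + c : ℕ) - q < n - (q + 1) + 1 then
          x ((Fin.cons t u : Fin (n - (q + 1) + 1) → ℝ) ⟨q + c - q, h⟩) else 1 := fun c => by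
        have hc : (q + c : ℕ) - q = 0 := by omega
        simp [hc]
      exact h5 _
    · intro i
      have h6 : (q + 1 + highWord σ q.succ i : ℕ) - q = highWord σ q.succ i + 1 := by omega
      refine Eq.trans ?_ (dif_pos (h6.trans_lt
        (Nat.succ_lt_succ (highWord σ q.succ i).2))).symm
      exact congrArg (fun l => x ((Fin.cons t u : Fin (n - (q + 1) + 1) → ℝ) l))
        (Fin.ext h6.symm : (highWord σ q.succ i).succ = ⟨_, h6.trans_lt
          (Nat.succ_lt_succ (highWord σ q.succ i).2)⟩)

/-- On a single component the two sums match after a shift of the cut by one. The top cut is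
constant in time, and the bottom cut is killed by `topContr` because the root has no vertex. -/
theorem hasCoordDerivAt_flow {x : ℝ → A} (hx : Continuous x) (s t : ℝ) (v : LTA A) :
    HasCoordDerivAt (fun r => flow x s r v) (topContr (x t) (flow x s t v)) t := by
  induction v using lta_induction with
  | h0 =>
    simp only [map_zero]
    exact HasCoordDerivAt.const 0 t
  | ha v w hv hw =>
    simp only [map_add]
    exact hv.add hw
  | hs τ a =>
    simp only [flow_single]
    rw [map_sum, Fin.sum_univ_succ, topContr_single_of_eq_zero _ _ rfl, zero_add]
    have h : ∀ r, ∑ p : Fin (τ.1 + 1), single (τ.lower p) ((τ.upper p).op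
        (iterVel x (τ.upper p).perm s r) a) = ∑ q : Fin τ.1, single (τ.lower q.castSucc)
          ((τ.upper q.castSucc).op (iterVel x (τ.upper q.castSucc).perm s r) a) + single τ a :=
      fun r => by rw [Fin.sum_univ_castSucc, single_op_upper_last]
    simp only [h]
    have := (HasCoordDerivAt.sum Finset.univ fun q _ =>
      hasCoordDerivAt_flow_castSucc hx s t τ a q).add (HasCoordDerivAt.const (single τ a) t)
    rwa [add_zero] at this

/-- As functions of the final time both sides solve the same equation, and they agree at `u`, where
`flow x u u` is the identity. -/
theorem flow_comp {x : ℝ → A} (hx : Continuous x) (s u t : ℝ) :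
    flow x s t = flow x u t ∘ₗ flow x s u := by
  refine LinearMap.ext fun v => ?_
  have := eq_zero_of_hasCoordDerivAt (x := x) (s := u)
    (V := fun r => flow x s r v - flow x u r (flow x s u v)) (fun r => by
      rw [map_sub]
      exact (hasCoordDerivAt_flow hx s r v).sub (hasCoordDerivAt_flow hx u r (flow x s u v)))
    (by simp only [flow_self, Module.End.one_apply, sub_self]) t
  exact sub_eq_zero.1 this

/-- Since `topContr` is a derivation, the product of two solutions is a solution, with the same
value at time `s` as the left-hand side. -/
theorem flow_shuffle {x : ℝ → A} (hx : Continuous x) (s t : ℝ) (v w : LTA A) :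
    flow x s t (shuffle v w) = shuffle (flow x s t v) (flow x s t w) := by
  have := eq_zero_of_hasCoordDerivAt (x := x) (s := s)
    (V := fun r => flow x s r (shuffle v w) - shuffle (flow x s r v) (flow x s r w)) (fun r => by
      rw [map_sub, topContr_shuffle]
      exact (hasCoordDerivAt_flow hx s r _).sub
        ((hasCoordDerivAt_flow hx s r v).shuffle (hasCoordDerivAt_flow hx s r w)))
    (by simp only [flow_self, Module.End.one_apply, sub_self]) t
  exact sub_eq_zero.1 this

theorem flow_mem_G {x : ℝ → A} (hx : Continuous x) (s t : ℝ) : flow x s t ∈ G A := by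
  refine ⟨⟨?_, flow_shuffle hx s t⟩, ?_⟩
  · refine (flow_single x s t LTree.root _).trans ?_
    exact (Fin.sum_univ_one _).trans (single_op_upper_last x s t LTree.root _)
  · rintro τ _ ⟨a, rfl⟩
    rw [flow_single, Fin.sum_univ_castSucc, single_op_upper_last, add_sub_cancel_right]
    refine Submodule.sum_mem _ fun p _ => ?_
    refine Submodule.mem_iSup_of_mem (τ.lower p.castSucc)
      (Submodule.mem_iSup_of_mem ⟨⟨_, rfl⟩, fun h => ?_⟩ ⟨_, rfl⟩)
    have := congrArg Sigma.fst h
    exact p.2.ne this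

end Flow

/-! ### Unitriangular endomorphisms and the group structure -/

section Group

variable {A : Type*} [CStarAlgebra A]

/-- The sum of the components of the proper subtrees of `τ`. -/
def properSub (τ : LTree) : Submodule ℂ (LTA A) :=
  ⨆ (τ' : LTree) (_ : τ'.IsSubtree τ ∧ τ' ≠ τ), component (A := A) τ'

theorem properSub_le {τ : LTree} {P : Submodule ℂ (LTA A)}
    (h : ∀ τ' : LTree, τ'.IsSubtree τ → τ' ≠ τ → component (A := A) τ' ≤ P) : properSub τ ≤ P :=
  iSup_le fun τ' => iSup_le fun h' => h τ' h'.1 h'.2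

theorem component_le_properSub {τ τ' : LTree} (h : τ'.IsSubtree τ) (h' : τ' ≠ τ) :
    component (A := A) τ' ≤ properSub τ :=
  le_iSup_of_le τ' (le_iSup_of_le ⟨h, h'⟩ le_rfl)

theorem isSubtree_lt {τ τ' : LTree} (h : τ'.IsSubtree τ) (h' : τ' ≠ τ) : τ'.1 < τ.1 := by
  obtain ⟨p, rfl⟩ := h
  refine lt_of_le_of_ne p.is_le fun hp => h' ?_
  have : p = Fin.last τ.1 := Fin.ext hp
  rw [this, lower_last]

theorem isSubtree_trans {τ τ' τ'' : LTree} (h : τ''.IsSubtree τ') (h' : τ'.IsSubtree τ) :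
    τ''.IsSubtree τ := by
  obtain ⟨q, rfl⟩ := h'
  obtain ⟨p, rfl⟩ := h
  exact ⟨_, lower_lower τ q p⟩

theorem properSub_le_properSub {τ τ' : LTree} (h : τ'.IsSubtree τ) (h' : τ' ≠ τ) :
    properSub (A := A) τ' ≤ properSub τ :=
  properSub_le fun τ'' h1 h2 => component_le_properSub (isSubtree_trans h1 h) (by
    rintro rfl
    exact absurd (isSubtree_lt h h') (not_lt.2 (isSubtree_lt h1 h2).le))

theorem iSup_component : (⨆ τ : LTree, component (A := A) τ) = ⊤ := by
  refine eq_top_iff.2 fun v _ => ?_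
  induction v using lta_induction with
  | h0 => exact Submodule.zero_mem _
  | hs τ a => exact Submodule.mem_iSup_of_mem τ ⟨a, rfl⟩
  | ha v w hv hw => exact Submodule.add_mem _ (hv trivial) (hw trivial)

/-- `φ - id` strictly lowers the trees. -/
def Lowers (φ : Module.End ℂ (LTA A)) : Prop :=
  ∀ τ : LTree, ∀ v ∈ component (A := A) τ, φ v - v ∈ properSub τ

/-- Write `v = φ v - (φ v - v)`: the second term lies in components with fewer generations, which
are in the range by induction. -/
theorem Lowers.surjective {φ : Module.End ℂ (LTA A)} (h : Lowers φ) : Function.Surjective φ := by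
  have key : ∀ (n : ℕ) (τ : LTree), τ.1 = n → component (A := A) τ ≤ LinearMap.range φ := by
    intro n
    induction n using Nat.strong_induction_on with
    | _ n ih =>
      rintro τ rfl v hv
      have h1 : properSub (A := A) τ ≤ LinearMap.range φ :=
        properSub_le fun τ' h2 h3 => ih _ (isSubtree_lt h2 h3) τ' rfl
      have h2 := Submodule.sub_mem _ (LinearMap.mem_range_self φ v) (h1 (h τ v hv))
      rwa [sub_sub_cancel] at h2
  rw [← LinearMap.range_eq_top, eq_top_iff, ← iSup_component]
  exact iSup_le fun τ => key _ τ rfl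

/-- The map `φ - 1` is locally nilpotent, whereas it acts as -1 on the kernel of `φ`. -/
theorem Lowers.injective {φ : Module.End ℂ (LTA A)} (h : Lowers φ) : Function.Injective φ := by
  set N : Module.End ℂ (LTA A) := φ - 1 with hN
  have key : ∀ (n : ℕ) (τ : LTree), τ.1 = n → component (A := A) τ ≤ LinearMap.ker (N ^ (n + 1)) := by
    intro n
    induction n using Nat.strong_induction_on with
    | _ n ih =>
      rintro τ rfl v hv
      have h1 : properSub (A := A) τ ≤ LinearMap.ker (N ^ τ.1) :=
        properSub_le fun τ' h2 h3 => (ih _ (isSubtree_lt h2 h3) τ' rfl).trans fun w hw => by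
          rw [LinearMap.mem_ker] at hw ⊢
          rw [← Nat.sub_add_cancel (isSubtree_lt h2 h3), pow_add, Module.End.mul_apply, hw,
            map_zero]
      rw [LinearMap.mem_ker, pow_succ, Module.End.mul_apply]
      exact h1 (h τ v hv)
  have key' : ∀ v : LTA A, ∃ n, (N ^ n) v = 0 := by
    intro v
    induction v using lta_induction with
    | h0 => exact ⟨0, map_zero _⟩
    | hs τ a => exact ⟨τ.1 + 1, key _ τ rfl ⟨a, rfl⟩⟩
    | ha v w hv hw =>
      obtain ⟨n, hn⟩ := hv
      obtain ⟨m, hm⟩ := hw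
      refine ⟨m + n, ?_⟩
      rw [map_add, pow_add, Module.End.mul_apply, hn, map_zero, zero_add, pow_mul_comm,
        Module.End.mul_apply, hm, map_zero]
  rw [← LinearMap.ker_eq_bot, eq_bot_iff]
  intro v hv
  rw [LinearMap.mem_ker] at hv
  obtain ⟨n, hn⟩ := key' v
  have h1 : N v = -v := by rw [hN, LinearMap.sub_apply, hv, Module.End.one_apply, zero_sub]
  have h2 : ∀ k, (N ^ k) v = (-1 : ℂ) ^ k • v := by
    intro k
    induction k with
    | zero => simp
    | succ k ih => rw [pow_succ, Module.End.mul_apply, h1, map_neg, ih, pow_succ]; simp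
  rw [h2] at hn
  simpa using hn

theorem Lowers.map_properSub {φ : Module.End ℂ (LTA A)} (h : Lowers φ) (τ : LTree) {v : LTA A}
    (hv : v ∈ properSub τ) : φ v ∈ properSub τ := by
  have : properSub (A := A) τ ≤ (properSub τ).comap φ := properSub_le fun τ' h1 h2 w hw => by
    rw [Submodule.mem_comap, ← sub_add_cancel (φ w) w]
    exact Submodule.add_mem _ (properSub_le_properSub h1 h2 (h τ' w hw))
      (component_le_properSub h1 h2 hw)
  exact this hv

theorem Lowers.mul {φ ψ : Module.End ℂ (LTA A)} (hφ : Lowers φ) (hψ : Lowers ψ) :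
    Lowers (φ * ψ) := fun τ v hv => by
  have h1 := hφ.map_properSub τ (hψ τ v hv)
  have h2 := Submodule.add_mem _ h1 (hφ τ v hv)
  rwa [map_sub, sub_add_sub_cancel] at h2

/-- Since `ψ (φ v - v) = v - ψ v`, it suffices that `ψ` preserve the span of the proper subtrees,
which holds by induction on the number of generations. -/
theorem Lowers.inv {φ ψ : Module.End ℂ (LTA A)} (hφ : Lowers φ) (h : ψ * φ = 1) : Lowers ψ := by
  have hinv : ∀ v, ψ (φ v) = v := fun v => LinearMap.congr_fun h v
  have key : ∀ (n : ℕ) (τ : LTree), τ.1 = n → ∀ v ∈ component (A := A) τ, ψ v - v ∈ properSub τ := by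
    intro n
    induction n using Nat.strong_induction_on with
    | _ n ih =>
      rintro τ rfl v hv
      have h1 : properSub (A := A) τ ≤ (properSub τ).comap ψ := properSub_le fun τ' h2 h3 w hw => by
        rw [Submodule.mem_comap, ← sub_add_cancel (ψ w) w]
        exact Submodule.add_mem _
          (properSub_le_properSub h2 h3 (ih _ (isSubtree_lt h2 h3) τ' rfl w hw))
          (component_le_properSub h2 h3 hw)
      have h2 : ψ (φ v - v) ∈ properSub τ := h1 (hφ τ v hv)
      rw [map_sub, hinv] at h2
      rw [← neg_sub]
      exact Submodule.neg_mem _ h2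
  exact fun τ => key _ τ rfl

/-- Unitriangularity makes each element of `G A` bijective, hence a unit; the inverse is
multiplicative formally and unitriangular by `Lowers.inv`. -/
theorem exists_subgroup_image_eq_G :
    ∃ H : Subgroup (Module.End ℂ (LTA A))ˣ, Units.val '' (H : Set (Module.End ℂ (LTA A))ˣ) = G A := by
  refine ⟨{ carrier := {u | (u : Module.End ℂ (LTA A)) ∈ G A}
            mul_mem' := ?_
            one_mem' := ?_
            inv_mem' := ?_ }, ?_⟩
  · rintro u w ⟨⟨hu1, hu2⟩, hu3⟩ ⟨⟨hw1, hw2⟩, hw3⟩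
    refine ⟨⟨?_, fun v v' => ?_⟩, Lowers.mul hu3 hw3⟩
    · rw [Units.val_mul, Module.End.mul_apply, hw1, hu1]
    · simp only [Units.val_mul, Module.End.mul_apply, hw2, hu2]
  · refine ⟨⟨rfl, fun _ _ => rfl⟩, fun τ v _ => ?_⟩
    rw [Units.val_one, Module.End.one_apply, sub_self]
    exact Submodule.zero_mem _
  · rintro u ⟨⟨hu1, hu2⟩, hu3⟩
    have h1 : ∀ v, (↑u⁻¹ : Module.End ℂ (LTA A)) ((u : Module.End ℂ (LTA A)) v) = v := fun v =>
      LinearMap.congr_fun u.inv_mul v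
    have h2 : ∀ v, (u : Module.End ℂ (LTA A)) ((↑u⁻¹ : Module.End ℂ (LTA A)) v) = v := fun v =>
      LinearMap.congr_fun u.mul_inv v
    refine ⟨⟨?_, fun v w => ?_⟩, Lowers.inv hu3 u.inv_mul⟩
    · conv_lhs => rw [← hu1]
      exact h1 _
    · conv_lhs => rw [← h2 v, ← h2 w, ← hu2, h1]
  · ext φ
    constructor
    · rintro ⟨u, hu, rfl⟩
      exact hu
    · intro hφ
      have hb : Function.Bijective φ := ⟨Lowers.injective hφ.2, Lowers.surjective hφ.2⟩
      obtain ⟨u, hu⟩ := (Module.End.isUnit_iff φ).2 hb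
      exact ⟨u, by rw [← hu] at hφ; exact hφ, hu⟩

end Group

end

end LevelledSignature

/-! ### The main theorem -/

open LevelledSignature in
theorem mainTheorem3 {A : Type*} [CStarAlgebra A] (X : ℝ → A)
    (hX : ContDiffOn ℝ ∞ X (Set.Icc 0 1)) :
    (∃ H : Subgroup (Module.End ℂ (LTA A))ˣ, Units.val '' (H : Set (Module.End ℂ (LTA A))ˣ) = G A) ∧
    (∀ s ∈ Set.Icc (0 : ℝ) 1, ∀ t ∈ Set.Icc (0 : ℝ) 1, pathEndo X s t ∈ G A) ∧
    (∀ s ∈ Set.Icc (0 : ℝ) 1, ∀ u ∈ Set.Icc (0 : ℝ) 1, ∀ t ∈ Set.Icc (0 : ℝ) 1,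
      pathEndo X s t = pathEndo X u t ∘ₗ pathEndo X s u) := by
  have hc : ContinuousOn (derivWithin X (Set.Icc 0 1)) (Set.Icc (0 : ℝ) 1) :=
    hX.continuousOn_derivWithin (uniqueDiffOn_Icc zero_lt_one) (by simp)
  -- The velocity is extended by its endpoint values to a continuous function on `ℝ`, so that the
  -- differential equation holds at all real times.
  have hx : Continuous (Set.IccExtend (zero_le_one' ℝ)
      ((Set.Icc (0 : ℝ) 1).domRestrict (derivWithin X (Set.Icc 0 1)))) := hc.domRestrict.Icc_extend'
  have hX' : ∀ r ∈ Set.Icc (0 : ℝ) 1, derivWithin X (Set.Icc 0 1) r = Set.IccExtend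
      (zero_le_one' ℝ) ((Set.Icc (0 : ℝ) 1).domRestrict (derivWithin X (Set.Icc 0 1))) r :=
    fun r hr => by rw [Set.IccExtend_of_mem _ _ hr, Set.domRestrict_apply]
  refine ⟨exists_subgroup_image_eq_G, fun s hs t ht => ?_, fun s hs u hu t ht => ?_⟩
  · rw [pathEndo_eq_flow hX' hs ht]
    exact flow_mem_G hx s t
  · rw [pathEndo_eq_flow hX' hs ht, pathEndo_eq_flow hX' hu ht, pathEndo_eq_flow hX' hs hu]
    exact flow_comp hx s u t
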